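/- Let $n\ge 0$ be an integer. A complete flag $F$ in $\mathbb{C}^n$ is a chain of subspaces $F^0\subset F^1\subset\dots\subset F^n$ with $\dim F^j=j$; let $\mathcal{F}(\mathbb{C}^n)$ be the set of complete flags. Let $v_3$ be the volume of a maximal (equivalently, regular) ideal tetrahedron in hyperbolic $3$-space $\mathbb{H}^3$, and let $\mathrm{Vol}_{\mathbb{H}^3}:\mathbb{P}(\mathbb{C}^2)^4\to\mathbb{R}$ be the signed hyperbolic volume of ideal simplices with vertices in $\partial\mathbb{H}^3=\mathbb{P}(\mathbb{C}^2)=\mathbb{C}\cup\{\infty\}$, the simplex $(\infty,0,1,z)$ being positively oriented when $\operatorname{Im} z>0$. For a finite-dimensional complex vector space $V$ and vectors $x_0,\dots,x_3$ spanning $V$, set $$\mathrm{Vol}[V;(x_0,\dots,x_3)]=\mathrm{Vol}_{\mathbb{H}^3}([x_0],\dots,[x_3])$$ if $\dim V=2$ and all $x_i\neq 0$ (where $V$ is identified with $\mathbb{C}^2$ by any linear isomorphism), and $\mathrm{Vol}[V;(x_0,\dots,x_3)]=0$ otherwise. For $F_0,\dots,F_3\in\mathcal{F}(\mathbb{C}^n)$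 choose vectors $v_i^j$ with $F_i^j=\mathbb{C}v_i^j+F_i^{j-1}$ for $1\le j\le n$, and define $$B_n(F_0,\dots,F_3)=\sum_{(j_0,\dots,j_3)\in\{0,\dots,n-1\}^4}\mathrm{Vol}\left[\frac{\langle F_0^{j_0+1},\dots,F_3^{j_3+1}\rangle}{\langle F_0^{j_0},\dots,F_3^{j_3}\rangle};(v_0^{j_0+1},\dots,v_3^{j_3+1})\right],$$ where in each summand the vectors are replaced by their images in the quotient; the sum does not depend on the choice of the $v_i^j$. Let $F_0,F_1,F_2,F_3\in\mathcal{F}(\mathbb{C}^n)$ be a maximal $4$-tuple, in the sense that $$|B_n(F_0,F_1,F_2,F_3)|=\tfrac16\,n(n^2-1)\,v_3.$$ If $F\in\mathcal{F}(\mathbb{C}^n)$ satisfies $B_n(F_0,F_1,F_2,F)=B_n(F_0,F_1,F_2,F_3)$, then $F=F_3$. -/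

import Mathlib

noncomputable section

namespace FlagVolume

/-! ## Hyperbolic 3-space and ideal simplices

`ℍ³` is the upper half-space `{(w, t) ∈ ℂ × ℝ : 0 < t}`; its ideal boundary is `ℙ(ℂ²)`, where
`[z : 1]` corresponds to `z ∈ ℂ` and `[1 : 0]` to `∞`. -/

/-- Upper half-space, as a subset of `ℂ × ℝ`. -/
def upperHalfSpace : Set (ℂ × ℝ) := {p | 0 < p.2}

/-- The hyperbolic volume measure `t⁻³ dw dt` on upper half-space (curvature `-1`). -/
def hyperbolicVolume : MeasureTheory.Measure (ℂ × ℝ) :=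
  (MeasureTheory.volume.restrict upperHalfSpace).withDensity
    (fun p => ENNReal.ofReal ((p.2 ^ 3)⁻¹))

/-- The standard isometry from upper half-space onto the hyperboloid model, consisting of the
positive definite Hermitian `2 × 2` matrices of determinant one (the quadratic form `det` on
Hermitian matrices has signature `(1, 3)`). -/
def toHyperboloid (p : ℂ × ℝ) : Matrix (Fin 2) (Fin 2) ℂ :=
  ((p.2⁻¹ : ℝ) : ℂ) •
    !![((‖p.1‖ ^ 2 + p.2 ^ 2 : ℝ) : ℂ), p.1; (starRingEnd ℂ) p.1, 1]

/-- The light-like Hermitian matrix `v v*`; its ray is the ideal point `[v] ∈ ℙ(ℂ²) = ∂ℍ³`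
in the hyperboloid model. -/
def lightVector (v : Fin 2 → ℂ) : Matrix (Fin 2) (Fin 2) ℂ :=
  Matrix.vecMulVec v (star v)

/-- The ideal simplex with vertices `[v 0], …, [v 3] ∈ ∂ℍ³`, i.e. the hyperbolic convex hull of
these ideal points. In the hyperboloid model it is the intersection of the hyperboloid with the
convex cone spanned by the corresponding light rays. -/
def idealSimplex (v : Fin 4 → Fin 2 → ℂ) : Set (ℂ × ℝ) :=
  {p | p ∈ upperHalfSpace ∧ ∃ c : Fin 4 → ℝ, (∀ i, 0 ≤ c i) ∧
    toHyperboloid p = ∑ i, (c i : ℂ) • lightVector (v i)}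

/-- The (unsigned) hyperbolic volume of the ideal simplex with vertices `[v i]`. -/
def simplexVolume (v : Fin 4 → Fin 2 → ℂ) : ℝ :=
  (hyperbolicVolume (idealSimplex v)).toReal

/-- The determinant of two vectors of `ℂ²`. -/
def det₂ (u v : Fin 2 → ℂ) : ℂ := u 0 * v 1 - u 1 * v 0

/-- The cross-ratio, normalised so that `(∞, 0, 1, z)` has cross-ratio `z`. When two of the four
points coincide its value (possibly through division by zero) is `0` or `1`, hence real. -/
def crossRatio (v : Fin 4 → Fin 2 → ℂ) : ℂ :=
  (det₂ (v 0) (v 2) * det₂ (v 1) (v 3)) / (det₂ (v 0) (v 3) * det₂ (v 1) (v 2))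

/-- The signed hyperbolic volume of the ideal simplex with vertices `[v 0], …, [v 3]`. The simplex
with vertices `∞, 0, 1, z` is positively oriented iff `0 < Im z`, and flat iff `Im z = 0`. -/
def volH3 (v : Fin 4 → Fin 2 → ℂ) : ℝ :=
  Real.sign (crossRatio v).im * simplexVolume v

/-- The volume `v₃` of a maximal ideal tetrahedron of `ℍ³`. -/
def v₃ : ℝ :=
  sSup {r : ℝ | ∃ v : Fin 4 → Fin 2 → ℂ, (∀ i, v i ≠ 0) ∧ r = simplexVolume v}

open Classical in
/-- The function `Vol` on 4-tuples of vectors spanning a finite-dimensional complex vector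
space `V`: if `dim V = 2` and no vector vanishes, it is the signed volume of the ideal simplex that
the vectors define after identifying `V` with `ℂ²` (the choice of the identification is immaterial,
since `GL(2, ℂ)` acts on `ℍ³ ∪ ∂ℍ³` by orientation-preserving isometries); otherwise it is `0`. -/
def Vol (V : Type*) [AddCommGroup V] [Module ℂ V] [FiniteDimensional ℂ V] (x : Fin 4 → V) : ℝ :=
  if h : Module.finrank ℂ V = 2 then
    if ∀ i, x i ≠ 0 then
      volH3 (fun i => (Module.finBasisOfFinrankEq ℂ V h).equivFun (x i))
    else 0
  else 0

/-! ## Flags and affine flags -/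

/-- A complete flag `F⁰ ⊂ F¹ ⊂ ⋯ ⊂ Fⁿ` in `ℂⁿ` with `dim Fʲ = j`. -/
@[ext]
structure CompleteFlag (n : ℕ) where
  subspace : Fin (n + 1) → Submodule ℂ (Fin n → ℂ)
  monotone_subspace : Monotone subspace
  finrank_subspace : ∀ j, Module.finrank ℂ (subspace j) = j

/-- An affine flag: a complete flag with vectors such that `Fʲ⁺¹ = ℂ vʲ⁺¹ + Fʲ`. The vector
`vʲ⁺¹` is `vec j`, for `j = 0, …, n - 1`. -/
structure AffineFlag (n : ℕ) extends CompleteFlag n where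
  vec : Fin n → (Fin n → ℂ)
  subspace_succ : ∀ j : Fin n,
    subspace j.succ = Submodule.span ℂ {vec j} ⊔ subspace j.castSucc

variable {n : ℕ}

/-- The span `⟨F₀^{j₀}, …, F₃^{j₃}⟩`. -/
def lowerSpan (F : Fin 4 → AffineFlag n) (J : Fin 4 → Fin n) : Submodule ℂ (Fin n → ℂ) :=
  ⨆ i, (F i).subspace (J i).castSucc

/-- The span `⟨F₀^{j₀+1}, …, F₃^{j₃+1}⟩`. -/
def upperSpan (F : Fin 4 → AffineFlag n) (J : Fin 4 → Fin n) : Submodule ℂ (Fin n → ℂ) :=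
  ⨆ i, (F i).subspace (J i).succ

theorem vec_mem_upperSpan (F : Fin 4 → AffineFlag n) (J : Fin 4 → Fin n) (i : Fin 4) :
    (F i).vec (J i) ∈ upperSpan F J := by
  have h : (F i).vec (J i) ∈ (F i).subspace (J i).succ := by
    rw [(F i).subspace_succ]
    exact Submodule.mem_sup_left (Submodule.mem_span_singleton_self _)
  exact Submodule.mem_iSup_of_mem i h

/-- The quotient `⟨F₀^{j₀+1}, …, F₃^{j₃+1}⟩ / ⟨F₀^{j₀}, …, F₃^{j₃}⟩`. -/
abbrev spanQuotient (F : Fin 4 → AffineFlag n) (J : Fin 4 → Fin n) : Type :=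
  upperSpan F J ⧸ (lowerSpan F J).submoduleOf (upperSpan F J)

/-- The class of `vᵢ^{jᵢ+1}` in the quotient. -/
def quotientVec (F : Fin 4 → AffineFlag n) (J : Fin 4 → Fin n) (i : Fin 4) : spanQuotient F J :=
  Submodule.Quotient.mk ⟨(F i).vec (J i), vec_mem_upperSpan F J i⟩

/-- The cocycle `B_n` on 4-tuples of affine flags. -/
def affineB (F : Fin 4 → AffineFlag n) : ℝ :=
  ∑ J : Fin 4 → Fin n, Vol (spanQuotient F J) (quotientVec F J)

/-- Every complete flag underlies an affine flag. -/
theorem CompleteFlag.exists_affineFlag (F : CompleteFlag n) :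
    ∃ A : AffineFlag n, A.toCompleteFlag = F := by
  have key : ∀ j : Fin n, ∃ v : Fin n → ℂ,
      F.subspace j.succ = Submodule.span ℂ {v} ⊔ F.subspace j.castSucc := by
    intro j
    have hle : F.subspace j.castSucc ≤ F.subspace j.succ :=
      F.monotone_subspace (Fin.castSucc_lt_succ (i := j)).le
    have h1 := F.finrank_subspace j.castSucc
    have h2 := F.finrank_subspace j.succ
    simp only [Fin.val_castSucc, Fin.val_succ] at h1 h2
    have hlt : F.subspace j.castSucc < F.subspace j.succ := by
      refine lt_of_le_of_ne hle fun h => ?_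
      rw [h] at h1
      omega
    obtain ⟨v, hv, hv'⟩ := SetLike.exists_of_lt hlt
    refine ⟨v, (Submodule.eq_of_le_of_finrank_le ?_ ?_).symm⟩
    · exact sup_le ((Submodule.span_singleton_le_iff_mem _ _).2 hv) hle
    · have hlt' : F.subspace j.castSucc < Submodule.span ℂ {v} ⊔ F.subspace j.castSucc := by
        refine lt_of_le_of_ne le_sup_right fun h => hv' ?_
        rw [h]
        exact Submodule.mem_sup_left (Submodule.mem_span_singleton_self _)
      have := Submodule.finrank_lt_finrank_of_lt hlt'
      omega
  choose v hv using key
  exact ⟨{ F with vec := v, subspace_succ := hv }, rfl⟩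

/-- An affine flag over a given complete flag. -/
def CompleteFlag.toAffine (F : CompleteFlag n) : AffineFlag n := F.exists_affineFlag.choose

/-- The function `B_n` on 4-tuples of complete flags, induced by the one on affine flags (the
lifts are immaterial, since `Vol` only depends on the lines spanned by the vectors). -/
def B (F : Fin 4 → CompleteFlag n) : ℝ := affineB (fun i => (F i).toAffine)

end FlagVolume

end

/-! The nonzero terms of `B_n` are indexed, injectively, by triples of dimensions of partial spans,
of which there are `n (n² - 1) / 6`, and each is at most `v₃` in absolute value. Maximality
therefore forces every triple to occur and all terms to equal the same `±v₃`. Expressing the volume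
of an ideal tetrahedron through its dihedral angles shows that only the regular one is maximal, and
a regular tetrahedron is determined by three of its vertices and its orientation. Hence, once
`F₃^k` is known, `F₃^{k+1}` is determined modulo the lower span of each nonzero term it enters;
letting the index in `F₀` decrease to `0` gives it modulo `F₃^k`, and induction on `k` concludes. -/

noncomputable section

namespace FlagVolume

/-! ## Isometries of upper half-space -/

section Isometries

open MeasureTheory Complex
open scoped ComplexConjugate

theorem mem_upperHalfSpace {p : ℂ × ℝ} : p ∈ upperHalfSpace ↔ 0 < p.2 := Iff.rfl

theorem measurableSet_upperHalfSpace : MeasurableSet upperHalfSpace :=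
  measurableSet_lt measurable_const measurable_snd

theorem hyperbolicVolume_apply {s : Set (ℂ × ℝ)} (hs : MeasurableSet s) :
    hyperbolicVolume s = ∫⁻ p in s ∩ upperHalfSpace, ENNReal.ofReal ((p.2 ^ 3)⁻¹) := by
  rw [hyperbolicVolume, withDensity_apply _ hs, Measure.restrict_restrict hs]

instance isAddHaarMeasure_volume_complex_prod_real :
    (volume : Measure (ℂ × ℝ)).IsAddHaarMeasure := by
  rw [Measure.volume_eq_prod]
  infer_instance

theorem measurePreserving_hyperbolicVolume {e : (ℂ × ℝ) ≃ᵐ (ℂ × ℝ)}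
    {f' : ℂ × ℝ → (ℂ × ℝ) →L[ℝ] (ℂ × ℝ)}
    (hf : ∀ p ∈ upperHalfSpace, HasFDerivAt e (f' p) p)
    (hU : ∀ p, e p ∈ upperHalfSpace ↔ p ∈ upperHalfSpace)
    (hdet : ∀ p ∈ upperHalfSpace, |(f' p).det| * ((e p).2 ^ 3)⁻¹ = (p.2 ^ 3)⁻¹) :
    MeasurePreserving e hyperbolicVolume hyperbolicVolume := by
  refine ⟨e.measurable, Measure.ext fun s hs => ?_⟩
  have hs' : MeasurableSet (e ⁻¹' s) := e.measurable hs
  have himage : s ∩ upperHalfSpace = e '' (e ⁻¹' s ∩ upperHalfSpace) := by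
    rw [show upperHalfSpace = e ⁻¹' upperHalfSpace from (Set.ext hU).symm, ← Set.preimage_inter,
      Set.image_preimage_eq _ e.surjective, show e ⁻¹' upperHalfSpace = upperHalfSpace from
      Set.ext hU]
  have hm := hs'.inter measurableSet_upperHalfSpace
  rw [Measure.map_apply e.measurable hs, hyperbolicVolume_apply hs', hyperbolicVolume_apply hs,
    himage, lintegral_image_eq_lintegral_abs_det_fderiv_mul volume hm
      (fun p hp => (hf p hp.2).hasFDerivWithinAt) e.injective.injOn]
  refine setLIntegral_congr_fun hm fun p hp => ?_
  rw [← ENNReal.ofReal_mul (abs_nonneg _), hdet p hp.2]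

/-- The isometry `(w, t) ↦ (a w + b, |a| t)` of upper half-space. -/
def similarityEquiv (a b : ℂ) (ha : a ≠ 0) : (ℂ × ℝ) ≃ᵐ (ℂ × ℝ) where
  toFun p := (a * p.1 + b, ‖a‖ * p.2)
  invFun p := (a⁻¹ * (p.1 - b), ‖a‖⁻¹ * p.2)
  left_inv p := by ext <;> simp [ha]
  right_inv p := by ext <;> simp [ha]
  measurable_toFun := by
    simp only [Equiv.coe_fn_mk]
    fun_prop
  measurable_invFun := by
    simp only [Equiv.coe_fn_symm_mk]
    fun_prop

theorem similarityEquiv_apply (a b : ℂ) (ha : a ≠ 0) (p : ℂ × ℝ) :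
    similarityEquiv a b ha p = (a * p.1 + b, ‖a‖ * p.2) := rfl

theorem similarityEquiv_mem_upperHalfSpace_iff (a b : ℂ) (ha : a ≠ 0) (p : ℂ × ℝ) :
    similarityEquiv a b ha p ∈ upperHalfSpace ↔ p ∈ upperHalfSpace :=
  mul_pos_iff_of_pos_left (norm_pos_iff.2 ha)

theorem measurePreserving_similarityEquiv (a b : ℂ) (ha : a ≠ 0) :
    MeasurePreserving (similarityEquiv a b ha) hyperbolicVolume hyperbolicVolume := by
  have : 0 < ‖a‖ := norm_pos_iff.2 ha
  let L : (ℂ × ℝ) →ₗ[ℝ] (ℂ × ℝ) :=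
    LinearMap.prodMap ((LinearMap.mulLeft ℂ a).restrictScalars ℝ) (LinearMap.mulLeft ℝ ‖a‖)
  have hL : L.toContinuousLinearMap.det = ‖a‖ ^ 3 := by
    rw [ContinuousLinearMap.det, LinearMap.coe_toContinuousLinearMap, LinearMap.det_prodMap,
      LinearMap.det_restrictScalars, LinearMap.det_ring, LinearMap.det_ring,
      Algebra.norm_complex_eq]
    simp only [LinearMap.mulLeft_apply, mul_one]
    change normSq a * ‖a‖ = ‖a‖ ^ 3
    rw [normSq_eq_norm_sq, ← pow_succ]
  refine measurePreserving_hyperbolicVolume (f' := fun _ => L.toContinuousLinearMap)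
    (fun p _ => ?_) (similarityEquiv_mem_upperHalfSpace_iff a b ha) fun p hp => ?_
  · refine (L.toContinuousLinearMap.hasFDerivAt.add_const ((b, 0) : ℂ × ℝ)).congr_of_eventuallyEq
      (Filter.Eventually.of_forall fun q => ?_)
    simp [similarityEquiv_apply, L]
  · have hp' : 0 < p.2 := hp
    rw [hL, similarityEquiv_apply, abs_of_pos (by positivity)]
    field_simp

/-- The orientation-reversing isometry `(w, t) ↦ (conj w, t)` of upper half-space. -/
def conjEquiv : (ℂ × ℝ) ≃ᵐ (ℂ × ℝ) where
  toFun p := (conj p.1, p.2)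
  invFun p := (conj p.1, p.2)
  left_inv p := by simp
  right_inv p := by simp
  measurable_toFun := by
    simp only [Equiv.coe_fn_mk]
    fun_prop
  measurable_invFun := by
    simp only [Equiv.coe_fn_symm_mk]
    fun_prop

theorem conjEquiv_apply (p : ℂ × ℝ) : conjEquiv p = (conj p.1, p.2) := rfl

theorem measurePreserving_conjEquiv :
    MeasurePreserving conjEquiv hyperbolicVolume hyperbolicVolume := by
  let L : (ℂ × ℝ) →ₗ[ℝ] (ℂ × ℝ) := LinearMap.prodMap conjAe.toLinearMap LinearMap.id
  have hL : L.toContinuousLinearMap.det = -1 := by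
    rw [ContinuousLinearMap.det, LinearMap.coe_toContinuousLinearMap, LinearMap.det_prodMap,
      LinearMap.det_id, det_conjAe, mul_one]
  refine measurePreserving_hyperbolicVolume (f' := fun _ => L.toContinuousLinearMap)
    (fun p _ => L.toContinuousLinearMap.hasFDerivAt) (fun p => Iff.rfl) fun p _ => ?_
  rw [hL, conjEquiv_apply, abs_neg, abs_one, one_mul]

/-- The inversion `p ↦ p / (|w|² + t²)`, where `p = (w, t)`, in the unit hemisphere. It reverses
orientation. -/
def inversion (p : ℂ × ℝ) : ℂ × ℝ := (‖p.1‖ ^ 2 + p.2 ^ 2)⁻¹ • p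

theorem norm_sq_add_sq_inversion (p : ℂ × ℝ) :
    ‖(inversion p).1‖ ^ 2 + (inversion p).2 ^ 2 = (‖p.1‖ ^ 2 + p.2 ^ 2)⁻¹ := by
  rw [inversion, Prod.smul_fst, Prod.smul_snd, norm_smul, smul_eq_mul, mul_pow, mul_pow,
    Real.norm_eq_abs, sq_abs, ← mul_add, sq, mul_assoc]
  rcases eq_or_ne (‖p.1‖ ^ 2 + p.2 ^ 2) 0 with h | h
  · rw [h, _root_.inv_zero, zero_mul]
  · rw [inv_mul_cancel₀ h, mul_one]

theorem inversion_involutive : Function.Involutive inversion := by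
  intro p
  rw [inversion, norm_sq_add_sq_inversion, inversion, inv_inv, smul_smul]
  rcases eq_or_ne (‖p.1‖ ^ 2 + p.2 ^ 2) 0 with h | h
  · obtain ⟨h₁, h₂⟩ := (add_eq_zero_iff_of_nonneg (sq_nonneg _) (sq_nonneg _)).1 h
    have hp : p = 0 := Prod.ext (norm_eq_zero.1 (pow_eq_zero_iff two_ne_zero |>.1 h₁))
      (pow_eq_zero_iff two_ne_zero |>.1 h₂)
    rw [hp, smul_zero]
  · rw [mul_inv_cancel₀ h, one_smul]

theorem measurable_inversion : Measurable inversion := by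
  unfold inversion
  fun_prop

/-- `inversion` as a measurable equivalence. -/
def inversionEquiv : (ℂ × ℝ) ≃ᵐ (ℂ × ℝ) where
  toEquiv := inversion_involutive.toPerm
  measurable_toFun := measurable_inversion
  measurable_invFun := measurable_inversion

theorem inversionEquiv_apply (p : ℂ × ℝ) : inversionEquiv p = inversion p := rfl

theorem norm_sq_add_sq_pos {p : ℂ × ℝ} (hp : p ∈ upperHalfSpace) : 0 < ‖p.1‖ ^ 2 + p.2 ^ 2 := by
  have : 0 < p.2 := hp
  positivity

theorem inversion_mem_upperHalfSpace {p : ℂ × ℝ} (hp : p ∈ upperHalfSpace) :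
    inversion p ∈ upperHalfSpace :=
  mul_pos (inv_pos.2 (norm_sq_add_sq_pos hp)) hp

theorem inversion_mem_upperHalfSpace_iff (p : ℂ × ℝ) :
    inversion p ∈ upperHalfSpace ↔ p ∈ upperHalfSpace :=
  ⟨fun hp => inversion_involutive p ▸ inversion_mem_upperHalfSpace hp,
    inversion_mem_upperHalfSpace⟩

theorem exists_hasFDerivAt_inversion {p : ℂ × ℝ} (hp : p ∈ upperHalfSpace) :
    ∃ f' : (ℂ × ℝ) →L[ℝ] (ℂ × ℝ), HasFDerivAt inversion f' p ∧
      |f'.det| = ((‖p.1‖ ^ 2 + p.2 ^ 2)⁻¹) ^ 3 := by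
  let e := WithLp.prodContinuousLinearEquiv 2 ℝ ℂ ℝ
  have hnorm (q : ℂ × ℝ) : ‖e.symm q‖ ^ 2 = ‖q.1‖ ^ 2 + q.2 ^ 2 := by
    simp [WithLp.prod_norm_sq_eq_of_L2, e]
  have hconj (q : ℂ × ℝ) : inversion q = e (EuclideanGeometry.inversion 0 1 (e.symm q)) := by
    simp [inversion, EuclideanGeometry.inversion, hnorm]
  have hne : e.symm p ≠ 0 := fun h => (norm_sq_add_sq_pos hp).ne' (by simp [← hnorm, h])
  have hfinrank : Module.finrank ℝ (WithLp 2 (ℂ × ℝ)) = 3 := by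
    simp [e.toLinearEquiv.finrank_eq]
  let R := (ℝ ∙ (e.symm p - 0))ᗮ.reflection
  let D : WithLp 2 (ℂ × ℝ) →L[ℝ] WithLp 2 (ℂ × ℝ) := (1 / dist (e.symm p) 0) ^ 2 • R
  refine ⟨(e : WithLp 2 (ℂ × ℝ) →L[ℝ] (ℂ × ℝ)) ∘L D ∘L e.symm, ?_, ?_⟩
  · have hderiv := EuclideanGeometry.hasFDerivAt_inversion (R := 1) hne
    exact (e.hasFDerivAt.comp p (hderiv.comp p e.symm.hasFDerivAt)).congr_of_eventuallyEq
      (Filter.Eventually.of_forall hconj)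
  · have hdet : ((e : WithLp 2 (ℂ × ℝ) →L[ℝ] (ℂ × ℝ)) ∘L D ∘L e.symm).det =
        LinearMap.det ((1 / dist (e.symm p) 0) ^ 2 •
          (R.toLinearEquiv : WithLp 2 (ℂ × ℝ) →ₗ[ℝ] WithLp 2 (ℂ × ℝ))) :=
      LinearMap.det_conj _ e.toLinearEquiv
    rw [hdet, LinearMap.det_smul, Submodule.det_reflection, hfinrank, abs_mul, abs_neg_one_pow,
      mul_one, dist_zero_right, abs_of_nonneg (by positivity), one_div, inv_pow, hnorm]

theorem measurePreserving_inversionEquiv :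
    MeasurePreserving inversionEquiv hyperbolicVolume hyperbolicVolume := by
  choose! f' hf' hdet using fun p (hp : p ∈ upperHalfSpace) => exists_hasFDerivAt_inversion hp
  refine measurePreserving_hyperbolicVolume hf' inversion_mem_upperHalfSpace_iff fun p hp => ?_
  have hp' : 0 < p.2 := hp
  have := norm_sq_add_sq_pos hp
  rw [hdet p hp, inversionEquiv_apply, inversion, Prod.smul_snd, smul_eq_mul]
  field_simp

end Isometries

/-! ## Invariance of the volume of ideal simplices -/

section Invariance

open MeasureTheory Matrix Complex
open scoped ComplexConjugate

theorem lightVector_smul (c : ℂ) (v : Fin 2 → ℂ) :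
    lightVector (c • v) = ((‖c‖ ^ 2 : ℝ) : ℂ) • lightVector v := by
  rw [lightVector, lightVector, star_smul, smul_vecMulVec, vecMulVec_smul, smul_smul,
    ← normSq_eq_norm_sq, ← mul_conj]
  rfl

theorem lightVector_mulVec (g : Matrix (Fin 2) (Fin 2) ℂ) (v : Fin 2 → ℂ) :
    lightVector (g *ᵥ v) = g * lightVector v * gᴴ := by
  rw [lightVector, lightVector, star_mulVec, mul_vecMulVec, vecMulVec_mul]

theorem simplexVolume_eq_of_equiv {v v' : Fin 4 → Fin 2 → ℂ} {e : (ℂ × ℝ) ≃ᵐ (ℂ × ℝ)}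
    (he : MeasurePreserving e hyperbolicVolume hyperbolicVolume)
    (h : ∀ p, e p ∈ idealSimplex v' ↔ p ∈ idealSimplex v) :
    simplexVolume v' = simplexVolume v := by
  have hpreimage : e ⁻¹' idealSimplex v' = idealSimplex v := Set.ext h
  rw [simplexVolume, simplexVolume, ← hpreimage, he.measure_preimage_equiv]

theorem idealSimplex_smul_subset (v : Fin 4 → Fin 2 → ℂ) (c : Fin 4 → ℂ) :
    idealSimplex (fun i => c i • v i) ⊆ idealSimplex v := by
  rintro p ⟨hp, k, hk, h⟩
  refine ⟨hp, fun i => k i * ‖c i‖ ^ 2, fun i => mul_nonneg (hk i) (by positivity), ?_⟩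
  simp only [h, lightVector_smul, smul_smul, ofReal_mul]

theorem simplexVolume_smul (v : Fin 4 → Fin 2 → ℂ) {c : Fin 4 → ℂ} (hc : ∀ i, c i ≠ 0) :
    simplexVolume (fun i => c i • v i) = simplexVolume v := by
  have hsubset := idealSimplex_smul_subset (fun i => c i • v i) (fun i => (c i)⁻¹)
  simp only [smul_smul, inv_mul_cancel₀ (hc _), one_smul] at hsubset
  rw [simplexVolume, simplexVolume, (idealSimplex_smul_subset v c).antisymm hsubset]

theorem mem_idealSimplex_mulVec {g : Matrix (Fin 2) (Fin 2) ℂ} {v : Fin 4 → Fin 2 → ℂ}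
    {p q : ℂ × ℝ} {k : ℝ} (hk : 0 ≤ k) (hq : q ∈ upperHalfSpace)
    (hpq : toHyperboloid q = (k : ℂ) • (g * toHyperboloid p * gᴴ)) (hp : p ∈ idealSimplex v) :
    q ∈ idealSimplex (fun i => g *ᵥ v i) := by
  obtain ⟨-, c, hc, hsum⟩ := hp
  refine ⟨hq, fun i => k * c i, fun i => mul_nonneg hk (hc i), ?_⟩
  simp only [hpq, hsum, Finset.mul_sum, Finset.sum_mul, Finset.smul_sum, lightVector_mulVec,
    Matrix.mul_smul, Matrix.smul_mul, smul_smul, ofReal_mul]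

theorem simplexVolume_mulVec_of_equivariant {e : (ℂ × ℝ) ≃ᵐ (ℂ × ℝ)}
    (he : MeasurePreserving e hyperbolicVolume hyperbolicVolume)
    (hU : ∀ p, e p ∈ upperHalfSpace ↔ p ∈ upperHalfSpace)
    {g : Matrix (Fin 2) (Fin 2) ℂ} (hg : IsUnit g.det) {k : ℝ} (hk : 0 < k)
    (h : ∀ p ∈ upperHalfSpace, toHyperboloid (e p) = (k : ℂ) • (g * toHyperboloid p * gᴴ))
    (v : Fin 4 → Fin 2 → ℂ) : simplexVolume (fun i => g *ᵥ v i) = simplexVolume v := by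
  refine simplexVolume_eq_of_equiv he fun p => ⟨fun hp => ?_, fun hp => ?_⟩
  · have hpU := (hU p).1 hp.1
    have hinv : toHyperboloid p = ((k⁻¹ : ℝ) : ℂ) • (g⁻¹ * toHyperboloid (e p) * (g⁻¹)ᴴ) := by
      have hk' : (k : ℂ) ≠ 0 := ofReal_ne_zero.2 hk.ne'
      rw [h p hpU, Matrix.mul_smul, Matrix.smul_mul, smul_smul, ofReal_inv,
        inv_mul_cancel₀ hk', one_smul, Matrix.mul_assoc g, nonsing_inv_mul_cancel_left _ _ hg,
        Matrix.mul_assoc, ← conjTranspose_mul, nonsing_inv_mul _ hg, conjTranspose_one,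
        Matrix.mul_one]
    simpa only [mulVec_mulVec, nonsing_inv_mul _ hg, one_mulVec] using
      mem_idealSimplex_mulVec (inv_nonneg.2 hk.le) hpU hinv hp
  · exact mem_idealSimplex_mulVec hk.le ((hU p).2 hp.1) (h p hp.1) hp

theorem toHyperboloid_similarityEquiv (a b : ℂ) (ha : a ≠ 0) {p : ℂ × ℝ}
    (hp : p ∈ upperHalfSpace) : toHyperboloid (similarityEquiv a b ha p) =
      ((‖a‖⁻¹ : ℝ) : ℂ) • (!![a, b; 0, 1] * toHyperboloid p * !![a, b; 0, 1]ᴴ) := by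
  have hp' : (p.2 : ℂ) ≠ 0 := ofReal_ne_zero.2 (mem_upperHalfSpace.1 hp).ne'
  have ha' : (‖a‖ : ℂ) ≠ 0 := ofReal_ne_zero.2 (norm_ne_zero_iff.2 ha)
  ext i j
  fin_cases i <;> fin_cases j <;>
    simp [toHyperboloid, similarityEquiv_apply, Matrix.vecMul, dotProduct, Fin.sum_univ_two,
      mul_pow, ← conj_mul'] <;>
    (field_simp; try ring)

theorem simplexVolume_affine {a : ℂ} (ha : a ≠ 0) (b : ℂ) (v : Fin 4 → Fin 2 → ℂ) :
    simplexVolume (fun i => !![a, b; 0, 1] *ᵥ v i) = simplexVolume v :=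
  simplexVolume_mulVec_of_equivariant (measurePreserving_similarityEquiv a b ha)
    (similarityEquiv_mem_upperHalfSpace_iff a b ha) (by simpa using ha)
    (inv_pos.2 (norm_pos_iff.2 ha)) (fun _ hp => toHyperboloid_similarityEquiv a b ha hp) v

theorem toHyperboloid_conjEquiv_inversion {p : ℂ × ℝ} (hp : p ∈ upperHalfSpace) :
    toHyperboloid (conjEquiv (inversion p)) =
      !![0, 1; 1, 0] * toHyperboloid p * !![0, 1; 1, 0]ᴴ := by
  have hp' : (p.2 : ℂ) ≠ 0 := ofReal_ne_zero.2 (mem_upperHalfSpace.1 hp).ne'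
  have hpos : (‖p.1‖ : ℂ) ^ 2 + (p.2 : ℂ) ^ 2 ≠ 0 := by
    exact_mod_cast (norm_sq_add_sq_pos hp).ne'
  simp only [toHyperboloid, conjEquiv_apply, RCLike.norm_conj, norm_sq_add_sq_inversion]
  ext i j
  fin_cases i <;> fin_cases j <;>
    simp [inversion, Matrix.vecMul, dotProduct, Fin.sum_univ_two] <;> field_simp

theorem simplexVolume_swap (v : Fin 4 → Fin 2 → ℂ) :
    simplexVolume (fun i => !![0, 1; 1, 0] *ᵥ v i) = simplexVolume v :=
  simplexVolume_mulVec_of_equivariant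
    (measurePreserving_conjEquiv.comp measurePreserving_inversionEquiv)
    (e := inversionEquiv.trans conjEquiv) inversion_mem_upperHalfSpace_iff (by simp) one_pos
    (fun p hp => by
      rw [ofReal_one, one_smul]
      exact toHyperboloid_conjEquiv_inversion hp) v

theorem simplexVolume_upperTriangular {a d : ℂ} (ha : a ≠ 0) (b : ℂ) (hd : d ≠ 0)
    (v : Fin 4 → Fin 2 → ℂ) :
    simplexVolume (fun i => !![a, b; 0, d] *ᵥ v i) = simplexVolume v := by
  have hg : !![a, b; 0, d] = d • !![a / d, b / d; 0, 1] := by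
    ext i j
    fin_cases i <;> fin_cases j <;> simp [mul_div_cancel₀, hd]
  simp only [hg, smul_mulVec]
  rw [simplexVolume_smul _ fun _ => hd, simplexVolume_affine (div_ne_zero ha hd)]

theorem simplexVolume_mulVec {g : Matrix (Fin 2) (Fin 2) ℂ} (hg : g.det ≠ 0)
    (v : Fin 4 → Fin 2 → ℂ) : simplexVolume (fun i => g *ᵥ v i) = simplexVolume v := by
  rw [det_fin_two] at hg
  rcases eq_or_ne (g 1 0) 0 with h | h
  · rw [h, mul_zero, sub_zero] at hg
    rw [eta_fin_two g, h, simplexVolume_upperTriangular (left_ne_zero_of_mul hg) _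
      (right_ne_zero_of_mul hg)]
  · have hbruhat : g = !![1, g 0 0 / g 1 0; 0, 1] * (!![0, 1; 1, 0] *
        !![g 1 0, g 1 1; 0, g 0 1 - g 0 0 * g 1 1 / g 1 0]) := by
      ext i j
      fin_cases i <;> fin_cases j <;> simp [h]
      ring
    have hd : g 0 1 - g 0 0 * g 1 1 / g 1 0 ≠ 0 := fun h' => hg <| by
      field_simp at h'
      linear_combination -h'
    rw [hbruhat]
    simp only [← mulVec_mulVec]
    rw [simplexVolume_affine one_ne_zero, simplexVolume_swap, simplexVolume_upperTriangular h _ hd]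

theorem lightVector_star (v : Fin 2 → ℂ) : lightVector (star v) = (lightVector v).map conj := by
  ext i j
  simp [lightVector, vecMulVec_apply]

theorem toHyperboloid_conjEquiv (p : ℂ × ℝ) :
    toHyperboloid (conjEquiv p) = (toHyperboloid p).map conj := by
  ext i j
  fin_cases i <;> fin_cases j <;> simp [toHyperboloid, conjEquiv_apply]

theorem simplexVolume_conj (v : Fin 4 → Fin 2 → ℂ) :
    simplexVolume (fun i => star (v i)) = simplexVolume v := by
  refine simplexVolume_eq_of_equiv measurePreserving_conjEquiv fun p => ?_
  have hsum (c : Fin 4 → ℝ) : ∑ i, (c i : ℂ) • lightVector (star (v i)) =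
      (∑ i, (c i : ℂ) • lightVector (v i)).map conj := by
    ext i j
    simp [lightVector_star, Matrix.sum_apply]
  simp only [idealSimplex, Set.mem_ofPred_eq, toHyperboloid_conjEquiv, hsum,
    (Matrix.map_injective (starRingEnd ℂ).injective).eq_iff]
  rfl

end Invariance

/-! ## The volume of an ideal tetrahedron in terms of its dihedral angles -/

section AngleVolume

open MeasureTheory Real

/-- The primitive of `-log sin` vanishing at `0`; up to a linear term, it is the Lobachevsky
function. -/
def logSinPrimitive (x : ℝ) : ℝ := -∫ t in (0 : ℝ)..x, log (sin t)

theorem logSinPrimitive_zero : logSinPrimitive 0 = 0 := by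
  rw [logSinPrimitive, intervalIntegral.integral_same, neg_zero]

theorem intervalIntegrable_log_sin_apply (x y : ℝ) :
    IntervalIntegrable (fun t => log (sin t)) volume x y :=
  intervalIntegrable_log_sin

theorem integral_log_sin_eq_sub (x y : ℝ) :
    ∫ t in x..y, log (sin t) = logSinPrimitive x - logSinPrimitive y := by
  rw [logSinPrimitive, logSinPrimitive, neg_sub_neg,
    intervalIntegral.integral_interval_sub_left (intervalIntegrable_log_sin_apply _ _)
      (intervalIntegrable_log_sin_apply _ _)]

theorem logSinPrimitive_pi_sub (x : ℝ) :
    logSinPrimitive (π - x) = logSinPrimitive π - logSinPrimitive x := by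
  have h := intervalIntegral.integral_comp_sub_left (a := 0) (b := x)
    (fun t => log (sin t)) π
  simp only [sin_pi_sub, integral_log_sin_eq_sub, logSinPrimitive_zero, sub_zero] at h
  linarith

theorem intervalIntegrable_log_sin_add (d x y : ℝ) :
    IntervalIntegrable (fun t => log (sin (t + d))) volume x y := by
  simpa only [add_sub_cancel_right] using
    (intervalIntegrable_log_sin_apply (x + d) (y + d)).comp_add_right d

theorem intervalIntegrable_log_sin_sub_left (d x y : ℝ) :
    IntervalIntegrable (fun t => log (sin (d - t))) volume x y := by
  simpa only [sub_sub_cancel] using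
    (intervalIntegrable_log_sin_apply (d - x) (d - y)).comp_sub_left d

theorem logSinPrimitive_add_lt_of_le {a b x y : ℝ} (ha : 0 < a) (hax : a < x) (hxy : x ≤ y)
    (hsum : a + b = x + y) (hπ : a + b < π) :
    logSinPrimitive a + logSinPrimitive b < logSinPrimitive x + logSinPrimitive y := by
  have hpos : 0 < ∫ t in a..x, (log (sin (a + b - t)) - log (sin t)) := by
    refine intervalIntegral.intervalIntegral_pos_of_pos_on
      ((intervalIntegrable_log_sin_sub_left _ _ _).sub (intervalIntegrable_log_sin_apply _ _))
      (fun t ht => sub_pos.2 (log_lt_log ?_ ?_)) hax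
    · exact sin_pos_of_pos_of_lt_pi (by linarith [ht.1]) (by linarith [ht.2])
    · rw [← sub_pos, sin_sub_sin]
      refine mul_pos (mul_pos two_pos (sin_pos_of_pos_of_lt_pi ?_ ?_))
        (cos_pos_of_mem_Ioo ⟨?_, ?_⟩)
      all_goals linarith [ht.1, ht.2]
  rw [intervalIntegral.integral_sub (intervalIntegrable_log_sin_sub_left _ _ _)
      (intervalIntegrable_log_sin_apply _ _),
    intervalIntegral.integral_comp_sub_left (fun t => log (sin t)),
    integral_log_sin_eq_sub, integral_log_sin_eq_sub, add_sub_cancel_left,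
    show a + b - x = y by linarith] at hpos
  linarith

theorem logSinPrimitive_add_lt {a b x y : ℝ} (ha : 0 < a) (hax : a < x) (hay : a < y)
    (hsum : a + b = x + y) (hπ : a + b < π) :
    logSinPrimitive a + logSinPrimitive b < logSinPrimitive x + logSinPrimitive y := by
  rcases le_total x y with h | h
  · exact logSinPrimitive_add_lt_of_le ha hax h hsum hπ
  · rw [add_comm (logSinPrimitive x)]
    exact logSinPrimitive_add_lt_of_le ha hay h (hsum.trans (add_comm x y)) hπ

/-- `a`, `b`, `c` are the angles of a nondegenerate Euclidean triangle. These triples are also the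
dihedral angles of the nondegenerate ideal tetrahedra. -/
structure IsTriangle (a b c : ℝ) : Prop where
  pos₁ : 0 < a
  pos₂ : 0 < b
  pos₃ : 0 < c
  sum_eq : a + b + c = π

namespace IsTriangle

variable {a b c : ℝ}

theorem rotate (h : IsTriangle a b c) : IsTriangle b c a :=
  ⟨h.pos₂, h.pos₃, h.pos₁, by linarith [h.sum_eq]⟩

theorem swap (h : IsTriangle a b c) : IsTriangle a c b :=
  ⟨h.pos₁, h.pos₃, h.pos₂, by linarith [h.sum_eq]⟩

theorem lt_pi (h : IsTriangle a b c) : a < π := by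
  linarith [h.pos₂, h.pos₃, h.sum_eq]

theorem sin_pos (h : IsTriangle a b c) : 0 < sin a :=
  sin_pos_of_pos_of_lt_pi h.pos₁ h.lt_pi

end IsTriangle

theorem isTriangle_pi_div_three : IsTriangle (π / 3) (π / 3) (π / 3) :=
  ⟨by positivity, by positivity, by positivity, by ring⟩

/-- The volume of the ideal tetrahedron with dihedral angles `a`, `b`, `c`. -/
def angleVolume (a b c : ℝ) : ℝ :=
  logSinPrimitive a + logSinPrimitive b + logSinPrimitive c - logSinPrimitive π

theorem angleVolume_rotate (a b c : ℝ) : angleVolume b c a = angleVolume a b c := by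
  unfold angleVolume
  ring

theorem angleVolume_swap (a b c : ℝ) : angleVolume a c b = angleVolume a b c := by
  unfold angleVolume
  ring

theorem angleVolume_lt_of_lt_of_lt {a b c : ℝ} (h : IsTriangle a b c) (ha : a < π / 3)
    (hb : π / 3 < b) : angleVolume a b c < angleVolume (π / 3) (a + b - π / 3) c := by
  have := logSinPrimitive_add_lt (b := b) (x := π / 3) (y := a + b - π / 3) h.pos₁ ha
    (by linarith) (by ring) (by linarith [h.pos₃, h.sum_eq])
  unfold angleVolume
  linarith

theorem angleVolume_pi_div_three_le {b c : ℝ} (h : IsTriangle (π / 3) b c) :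
    angleVolume (π / 3) b c ≤ angleVolume (π / 3) (π / 3) (π / 3) := by
  wlog hbc : b ≤ c generalizing b c
  · rw [angleVolume_swap]
    exact this h.swap (le_of_not_ge hbc)
  have hsum := h.sum_eq
  rcases eq_or_lt_of_le (show b ≤ π / 3 by linarith) with rfl | hb
  · rw [show c = π / 3 by linarith]
  · have := logSinPrimitive_add_lt (b := c) h.pos₂ hb hb (by linarith) (by linarith [h.pos₁])
    unfold angleVolume
    linarith

theorem angleVolume_lt_of_lt {a b c : ℝ} (h : IsTriangle a b c) (ha : a < π / 3) :
    angleVolume a b c < angleVolume (π / 3) (π / 3) (π / 3) := by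
  wlog hb : π / 3 < b generalizing b c
  · rw [angleVolume_swap]
    exact this h.swap (by linarith [h.sum_eq])
  refine (angleVolume_lt_of_lt_of_lt h ha hb).trans_le (angleVolume_pi_div_three_le ?_)
  exact ⟨by positivity, by linarith [h.pos₁], h.pos₃, by linarith [h.sum_eq]⟩

theorem angleVolume_lt {a b c : ℝ} (h : IsTriangle a b c) (hne : ¬(a = π / 3 ∧ b = π / 3)) :
    angleVolume a b c < angleVolume (π / 3) (π / 3) (π / 3) := by
  by_cases ha : a < π / 3
  · exact angleVolume_lt_of_lt h ha
  by_cases hb : b < π / 3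
  · rw [← angleVolume_rotate]
    exact angleVolume_lt_of_lt h.rotate hb
  have hc : c < π / 3 := by
    by_contra hc
    exact hne ⟨by linarith [h.sum_eq], by linarith [h.sum_eq]⟩
  rw [← angleVolume_rotate, ← angleVolume_rotate]
  exact angleVolume_lt_of_lt h.rotate.rotate hc

theorem intervalIntegrable_half_log_sin (a b c : ℝ) :
    IntervalIntegrable (fun t => (log (sin (t + b)) + log (sin (t + c)) -
      log (sin t) - log (sin (a - t))) / 2) volume 0 a :=
  ((((intervalIntegrable_log_sin_add b 0 a).add (intervalIntegrable_log_sin_add c 0 a)).sub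
    (intervalIntegrable_log_sin_apply 0 a)).sub
      (intervalIntegrable_log_sin_sub_left a 0 a)).div_const 2

theorem integral_half_log_sin {a b c : ℝ} (h : a + b + c = π) :
    ∫ t in (0 : ℝ)..a, (log (sin (t + b)) + log (sin (t + c)) -
      log (sin t) - log (sin (a - t))) / 2 = angleVolume a b c := by
  have hb := intervalIntegrable_log_sin_add b 0 a
  have hc := intervalIntegrable_log_sin_add c 0 a
  have hsin := intervalIntegrable_log_sin_apply 0 a
  rw [intervalIntegral.integral_div,
    intervalIntegral.integral_sub ((hb.add hc).sub hsin)
      (intervalIntegrable_log_sin_sub_left a 0 a),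
    intervalIntegral.integral_sub (hb.add hc) hsin, intervalIntegral.integral_add hb hc,
    intervalIntegral.integral_comp_add_right (fun t => log (sin t)),
    intervalIntegral.integral_comp_add_right (fun t => log (sin t)),
    intervalIntegral.integral_comp_sub_left (fun t => log (sin t)),
    integral_log_sin_eq_sub, integral_log_sin_eq_sub, integral_log_sin_eq_sub,
    integral_log_sin_eq_sub, show a + b = π - c by linarith, show a + c = π - b by linarith,
    logSinPrimitive_pi_sub, logSinPrimitive_pi_sub, sub_self, sub_zero, zero_add, zero_add,
    logSinPrimitive_zero, angleVolume]
  ring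

end AngleVolume

/-! ## The simplex with vertices `∞, 0, 1, z` -/

section StandardSimplex

open Matrix Complex
open scoped ComplexConjugate

/-- Representatives of the ideal points `∞, 0, 1, z`. -/
def standardVertices (z : ℂ) : Fin 4 → Fin 2 → ℂ := ![![1, 0], ![0, 1], ![1, 1], ![z, 1]]

/-- The defining functions of the four faces of the ideal simplex with vertices `∞, 0, 1, z`:
the `i`-th one vanishes on the face opposite to the `i`-th vertex and, if `0 < z.im`, is nonnegative
on the simplex. The first face lies on a hemisphere, the others on vertical planes. -/
def faceForm (z : ℂ) (p : ℂ × ℝ) : Fin 4 → ℝ :=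
  ![(‖p.1‖ ^ 2 + p.2 ^ 2) * z.im - (p.1.re * z.im + p.1.im * (‖z‖ ^ 2 - z.re)),
    z.im - (p.1.re * z.im + p.1.im * (1 - z.re)),
    p.1.re * z.im - p.1.im * z.re,
    p.1.im]

theorem sum_smul_lightVector_standardVertices (z : ℂ) (c : Fin 4 → ℝ) :
    ∑ i, (c i : ℂ) • lightVector (standardVertices z i) =
      !![((c 0 + c 2 + c 3 * ‖z‖ ^ 2 : ℝ) : ℂ), c 2 + c 3 * z;
        c 2 + c 3 * conj z, ((c 1 + c 2 + c 3 : ℝ) : ℂ)] := by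
  ext i j
  fin_cases i <;> fin_cases j <;>
    simp [Matrix.sum_apply, Fin.sum_univ_four, lightVector, vecMulVec_apply, standardVertices,
      mul_conj']

theorem toHyperboloid_eq_iff {p : ℂ × ℝ} (hp : p ∈ upperHalfSpace) (x y : ℝ) (w : ℂ) :
    toHyperboloid p = !![(x : ℂ), w; conj w, (y : ℂ)] ↔
      ‖p.1‖ ^ 2 + p.2 ^ 2 = p.2 * x ∧ p.1.re = p.2 * w.re ∧ p.1.im = p.2 * w.im ∧
        1 = p.2 * y := by
  have hp' : p.2 ≠ 0 := (mem_upperHalfSpace.1 hp).ne'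
  simp only [← inv_mul_eq_iff_eq_mul₀ hp', toHyperboloid, ← Matrix.ext_iff, Fin.forall_fin_two,
    Matrix.smul_apply, smul_eq_mul, of_apply, cons_val_zero, cons_val_one, cons_val_fin_one,
    Complex.ext_iff, re_ofReal_mul, im_ofReal_mul, ofReal_re, ofReal_im, one_re, one_im, conj_re,
    conj_im, mul_neg, neg_inj, mul_one, mul_zero, and_true]
  tauto

theorem forall_fin_four {P : Fin 4 → Prop} : (∀ i, P i) ↔ P 0 ∧ P 1 ∧ P 2 ∧ P 3 := by
  simp only [Fin.forall_fin_succ, IsEmpty.forall_iff, and_true]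
  rfl

theorem toHyperboloid_eq_sum_iff {p : ℂ × ℝ} (hp : p ∈ upperHalfSpace) {z : ℂ} (hz : z.im ≠ 0)
    (c : Fin 4 → ℝ) :
    toHyperboloid p = ∑ i, (c i : ℂ) • lightVector (standardVertices z i) ↔
      ∀ i, c i * (p.2 * z.im) = faceForm z p i := by
  have hconj : (c 2 : ℂ) + c 3 * conj z = conj ((c 2 : ℂ) + c 3 * z) := by simp
  rw [sum_smul_lightVector_standardVertices, hconj, toHyperboloid_eq_iff hp]
  simp only [add_re, add_im, ofReal_re, ofReal_im, re_ofReal_mul, im_ofReal_mul, zero_add, faceForm,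
    forall_fin_four, cons_val]
  constructor
  · rintro ⟨h₀, h₁, h₂, h₃⟩
    refine ⟨?_, ?_, ?_, ?_⟩
    · linear_combination (-z.im) * h₀ + z.im * h₁ + (‖z‖ ^ 2 - z.re) * h₂
    · linear_combination (-z.im) * h₃ + z.im * h₁ + (1 - z.re) * h₂
    · linear_combination z.re * h₂ - z.im * h₁
    · linear_combination -h₂
  · rintro ⟨h₀, h₁, h₂, h₃⟩
    refine ⟨mul_right_cancel₀ hz ?_, mul_right_cancel₀ hz ?_, ?_, mul_right_cancel₀ hz ?_⟩
    · linear_combination -h₀ - h₂ - ‖z‖ ^ 2 * h₃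
    · linear_combination -h₂ - z.re * h₃
    · linear_combination -h₃
    · linear_combination -h₁ - h₂ - h₃

theorem mem_idealSimplex_standardVertices_iff {z : ℂ} (hz : 0 < z.im) (p : ℂ × ℝ) :
    p ∈ idealSimplex (standardVertices z) ↔ 0 < p.2 ∧ ∀ i, 0 ≤ faceForm z p i := by
  refine and_congr_right fun hp => ?_
  have hpos : 0 < p.2 * z.im := mul_pos hp hz
  simp only [toHyperboloid_eq_sum_iff hp hz.ne']
  constructor
  · rintro ⟨c, hc, h⟩ i
    rw [← h i]
    exact mul_nonneg (hc i) hpos.le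
  · exact fun h => ⟨fun i => faceForm z p i / (p.2 * z.im), fun i => div_nonneg (h i) hpos.le,
      fun i => div_mul_cancel₀ _ hpos.ne'⟩

theorem continuous_faceForm (z : ℂ) : Continuous (faceForm z) := by
  refine continuous_pi fun i => ?_
  fin_cases i <;> (simp only [faceForm]; dsimp; fun_prop)

theorem measurableSet_idealSimplex_standardVertices {z : ℂ} (hz : 0 < z.im) :
    MeasurableSet (idealSimplex (standardVertices z)) := by
  have heq : idealSimplex (standardVertices z) =
      upperHalfSpace ∩ ⋂ i, {p | 0 ≤ faceForm z p i} := by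
    ext p
    simp only [mem_idealSimplex_standardVertices_iff hz, Set.mem_inter_iff, Set.mem_iInter,
      mem_upperHalfSpace, Set.mem_ofPred_eq]
  rw [heq]
  exact measurableSet_upperHalfSpace.inter (.iInter fun i => (isClosed_le continuous_const
    ((continuous_apply i).comp (continuous_faceForm z))).measurableSet)

end StandardSimplex

section ThirdVertex

open Real

/-- The third vertex of the triangle with vertices `0`, `1`, `z` and angles `a`, `b`, `c`. -/
def thirdVertex (a b c : ℝ) : ℂ := Complex.polarCoord.symm (sin b / sin c, a)

theorem re_polarCoord_symm (r f : ℝ) : (Complex.polarCoord.symm (r, f)).re = r * cos f := by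
  simp [Complex.mul_re, -Complex.ofReal_cos, -Complex.ofReal_sin]

theorem im_polarCoord_symm (r f : ℝ) : (Complex.polarCoord.symm (r, f)).im = r * sin f := by
  simp [Complex.mul_im, -Complex.ofReal_cos, -Complex.ofReal_sin]

variable {a b c : ℝ}

theorem thirdVertex_im_pos (h : IsTriangle a b c) : 0 < (thirdVertex a b c).im := by
  rw [thirdVertex, im_polarCoord_symm]
  exact mul_pos (div_pos h.rotate.sin_pos h.rotate.rotate.sin_pos) h.sin_pos

theorem faceForm_thirdVertex (h : IsTriangle a b c) (r f t : ℝ) :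
    faceForm (thirdVertex a b c) (Complex.polarCoord.symm (r, f), t) =
      ![sin b / sin c * sin a * (t ^ 2 - r * (sin (f + c) / sin c - r)),
        sin a / sin c * (sin b - r * sin (f + b)),
        r * (sin b / sin c) * sin (a - f),
        r * sin f] := by
  have hc : sin c ≠ 0 := h.rotate.rotate.sin_pos.ne'
  have hsin_c : sin c = sin a * cos b + cos a * sin b := by
    rw [← sin_add, ← sin_pi_sub, ← h.sum_eq, add_sub_cancel_right]
  have hsin_b : sin b = sin a * cos c + cos a * sin c := by
    rw [← sin_add, ← sin_pi_sub, ← h.sum_eq, add_right_comm, add_sub_cancel_right]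
  have hnorm (ρ θ : ℝ) : ‖Complex.polarCoord.symm (ρ, θ)‖ ^ 2 = ρ ^ 2 := by
    rw [Complex.norm_polarCoord_symm, sq_abs]
  simp only [faceForm, thirdVertex, re_polarCoord_symm, im_polarCoord_symm, hnorm]
  congr 1
  · rw [sin_add]
    field_simp
    linear_combination (-sin b * r * sin f) * hsin_b
  congr 1
  · rw [sin_add]
    field_simp
    linear_combination (-r * sin f) * hsin_c
  congr 1
  rw [sin_sub]
  ring

theorem sin_nonneg_iff_of_mem_Ioo {x : ℝ} (hx : x ∈ Set.Ioo (-π) π) : 0 ≤ sin x ↔ 0 ≤ x := by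
  refine ⟨fun h => ?_, fun h => sin_nonneg_of_nonneg_of_le_pi h hx.2.le⟩
  contrapose! h
  exact sin_neg_of_neg_of_neg_pi_lt h hx.1

theorem mem_idealSimplex_polar_iff (h : IsTriangle a b c) {r f : ℝ} (hr : 0 < r)
    (hf : f ∈ Set.Ioo (-π) π) (t : ℝ) :
    (Complex.polarCoord.symm (r, f), t) ∈ idealSimplex (standardVertices (thirdVertex a b c)) ↔
      (f ∈ Set.Icc 0 a ∧ r ≤ sin b / sin (f + b)) ∧
        0 < t ∧ r * (sin (f + c) / sin c - r) ≤ t ^ 2 := by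
  have ha := h.sin_pos
  have hb := h.rotate.sin_pos
  have hc := h.rotate.rotate.sin_pos
  rw [mem_idealSimplex_standardVertices_iff (thirdVertex_im_pos h), faceForm_thirdVertex h]
  have hright : 0 ≤ r * sin f ↔ 0 ≤ f := by
    rw [mul_nonneg_iff_of_pos_left hr, sin_nonneg_iff_of_mem_Ioo hf]
  have hleft (hf₀ : 0 ≤ f) : 0 ≤ r * (sin b / sin c) * sin (a - f) ↔ f ≤ a := by
    rw [mul_nonneg_iff_of_pos_left (by positivity), sin_nonneg_iff_of_mem_Ioo, sub_nonneg]
    exact ⟨by linarith [h.pos₁, hf.2], by linarith [h.lt_pi]⟩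
  have hthird (hf₀ : 0 ≤ f) (hfa : f ≤ a) :
      0 ≤ sin a / sin c * (sin b - r * sin (f + b)) ↔ r ≤ sin b / sin (f + b) := by
    rw [mul_nonneg_iff_of_pos_left (by positivity), sub_nonneg, le_div_iff₀]
    exact sin_pos_of_pos_of_lt_pi (by linarith [h.pos₂]) (by linarith [h.pos₃, h.sum_eq])
  have hsphere : 0 ≤ sin b / sin c * sin a * (t ^ 2 - r * (sin (f + c) / sin c - r)) ↔
      r * (sin (f + c) / sin c - r) ≤ t ^ 2 := by
    rw [mul_nonneg_iff_of_pos_left (by positivity), sub_nonneg]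
  simp only [forall_fin_four, Matrix.cons_val, hsphere, hright, Set.mem_Icc]
  constructor
  · rintro ⟨ht, h₀, h₁, h₂, h₃⟩
    have hfa := (hleft h₃).1 h₂
    exact ⟨⟨⟨h₃, hfa⟩, (hthird h₃ hfa).1 h₁⟩, ht, h₀⟩
  · rintro ⟨⟨⟨h₃, h₂⟩, h₁⟩, ht, h₀⟩
    exact ⟨ht, h₀, (hthird h₃ h₂).2 h₁, (hleft h₃).2 h₂, h₃⟩

end ThirdVertex

/-! ## Volumes in polar coordinates -/

section ElementaryIntegrals

open MeasureTheory Real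

theorem setOf_pos_and_le_sq {q : ℝ} (hq : 0 < q) : {t : ℝ | 0 < t ∧ q ≤ t ^ 2} = Set.Ici (√q) := by
  ext t
  refine ⟨fun h => (sqrt_le_left h.1.le).2 h.2, fun h => ?_⟩
  have ht : 0 < t := (sqrt_pos.2 hq).trans_le h
  exact ⟨ht, (sqrt_le_left ht.le).1 h⟩

theorem lintegral_Ici_inv_pow_three {x : ℝ} (hx : 0 < x) :
    ∫⁻ t in Set.Ici x, ENNReal.ofReal ((t ^ 3)⁻¹) = ENNReal.ofReal ((2 * x ^ 2)⁻¹) := by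
  have hrpow : Set.EqOn (fun t : ℝ => ENNReal.ofReal ((t ^ 3)⁻¹))
      (fun t => ENNReal.ofReal (t ^ (-3 : ℝ))) (Set.Ioi x) := fun t ht => by
    simp only [rpow_neg (hx.trans ht).le]
    norm_cast
  rw [← restrict_Ioi_eq_restrict_Ici, setLIntegral_congr_fun measurableSet_Ioi hrpow,
    ← ofReal_integral_eq_lintegral_ofReal (integrableOn_Ioi_rpow_of_lt (by norm_num) hx),
    integral_Ioi_rpow_of_lt (by norm_num) hx]
  · rw [show (-3 : ℝ) + 1 = -(2 : ℕ) by norm_num, rpow_neg hx.le, rpow_natCast]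
    congr 1
    push_cast
    field_simp
  · filter_upwards [ae_restrict_mem measurableSet_Ioi] with t ht
    exact rpow_nonneg (hx.trans ht).le _

theorem lintegral_Ioc_inv_sub {l d : ℝ} (hl : 0 < l) (hd : l < d) :
    ∫⁻ r in Set.Ioc 0 l, ENNReal.ofReal ((2 * (d - r))⁻¹) =
      ENNReal.ofReal ((log d - log (d - l)) / 2) := by
  have hpos : ∀ r ∈ Set.uIcc 0 l, 0 < d - r := fun r hr => by
    rw [Set.uIcc_of_le hl.le] at hr
    exact sub_pos.2 (hr.2.trans_lt hd)
  have hderiv : ∀ r ∈ Set.uIcc 0 l,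
      HasDerivAt (fun r => -log (d - r) / 2) ((2 * (d - r))⁻¹) r := fun r hr => by
    have hne := (hpos r hr).ne'
    refine ((((hasDerivAt_id' r).const_sub d).log hne).fun_neg.div_const 2).congr_deriv ?_
    field_simp
  have hint : IntervalIntegrable (fun r => (2 * (d - r))⁻¹) volume 0 l :=
    ContinuousOn.intervalIntegrable (ContinuousOn.inv₀ (by fun_prop) fun r hr =>
      (mul_pos two_pos (hpos r hr)).ne')
  rw [← ofReal_integral_eq_lintegral_ofReal hint.1, ← intervalIntegral.integral_of_le hl.le,
    intervalIntegral.integral_eq_sub_of_hasDerivAt hderiv hint]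
  · rw [sub_zero]
    congr 1
    ring
  · filter_upwards [ae_restrict_mem measurableSet_Ioc] with r hr
    have := sub_pos.2 (hr.2.trans_lt hd)
    exact inv_nonneg.2 (by positivity)

end ElementaryIntegrals

section PolarRegion

open MeasureTheory Real

/-- The hyperbolic volume of `s` per unit of area of the boundary plane `ℂ`: the integral of the
hyperbolic density along the vertical fibre of `s` over `w`. -/
def fiberVolume (s : Set (ℂ × ℝ)) (w : ℂ) : ENNReal :=
  ∫⁻ t in {t | (w, t) ∈ s}, ENNReal.ofReal ((t ^ 3)⁻¹)

theorem hyperbolicVolume_eq_lintegral_polar {s : Set (ℂ × ℝ)} (hs : MeasurableSet s)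
    (hsU : s ⊆ upperHalfSpace) :
    hyperbolicVolume s = ∫⁻ f in Set.Ioo (-π) π, ∫⁻ r in Set.Ioi (0 : ℝ),
      ENNReal.ofReal r * fiberVolume s (Complex.polarCoord.symm (r, f)) := by
  have hdensity : Measurable (s.indicator fun p : ℂ × ℝ => ENNReal.ofReal ((p.2 ^ 3)⁻¹)) :=
    Measurable.indicator (by fun_prop) hs
  have hfiber (w : ℂ) : ∫⁻ t, s.indicator (fun p => ENNReal.ofReal ((p.2 ^ 3)⁻¹)) (w, t) =
      fiberVolume s w :=
    lintegral_indicator (measurable_prodMk_left hs) _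
  have hmeas : Measurable (fiberVolume s) := by
    simpa only [hfiber] using hdensity.lintegral_prod_right' (ν := volume)
  have hpolar : Measurable fun p : ℝ × ℝ => Complex.polarCoord.symm p := by
    simp only [Complex.polarCoord_symm_apply]
    fun_prop
  rw [hyperbolicVolume_apply hs, Set.inter_eq_left.2 hsU, ← lintegral_indicator hs,
    Measure.volume_eq_prod, lintegral_prod _ hdensity.aemeasurable]
  simp only [hfiber]
  rw [← Complex.lintegral_comp_polarCoord_symm, polarCoord_target, Measure.volume_eq_prod,
    ← Measure.prod_restrict, lintegral_prod_symm]
  · rfl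
  · exact (Measurable.mul (by fun_prop) (hmeas.comp hpolar)).aemeasurable

/-- In cylindrical coordinates `(r * exp (f * I), t)`, the set `s` consists of the points of upper
half-space above the sector `0 ≤ f ≤ a`, `r ≤ ρ f` and outside the surface
`r ^ 2 + t ^ 2 = r * δ f`. Nothing is said about the points with `r = 0` or `f = π`, which form a
null set. -/
def IsPolarRegion (s : Set (ℂ × ℝ)) (a : ℝ) (ρ δ : ℝ → ℝ) : Prop :=
  ∀ ⦃r⦄, 0 < r → ∀ ⦃f⦄, f ∈ Set.Ioo (-π) π → ∀ t,
    (Complex.polarCoord.symm (r, f), t) ∈ s ↔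
      (f ∈ Set.Icc 0 a ∧ r ≤ ρ f) ∧ 0 < t ∧ r * (δ f - r) ≤ t ^ 2

namespace IsPolarRegion

variable {s : Set (ℂ × ℝ)} {a : ℝ} {ρ δ : ℝ → ℝ} {r f : ℝ}

theorem fiberVolume_eq_zero (h : IsPolarRegion s a ρ δ) (hr : 0 < r) (hf : f ∈ Set.Ioo (-π) π)
    (hrf : ¬(f ∈ Set.Icc 0 a ∧ r ≤ ρ f)) : fiberVolume s (Complex.polarCoord.symm (r, f)) = 0 := by
  have hempty : {t | (Complex.polarCoord.symm (r, f), t) ∈ s} = ∅ :=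
    Set.eq_empty_of_forall_notMem fun t ht => hrf ((h hr hf t).1 ht).1
  rw [fiberVolume, hempty, Measure.restrict_empty, lintegral_zero_measure]

theorem ofReal_mul_fiberVolume (h : IsPolarRegion s a ρ δ) (hr : 0 < r) (hf : f ∈ Set.Ioo (-π) π)
    (hrf : f ∈ Set.Icc 0 a ∧ r ≤ ρ f) (hδ : r < δ f) :
    ENNReal.ofReal r * fiberVolume s (Complex.polarCoord.symm (r, f)) =
      ENNReal.ofReal ((2 * (δ f - r))⁻¹) := by
  have hq : 0 < r * (δ f - r) := mul_pos hr (sub_pos.2 hδ)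
  have hray : {t | (Complex.polarCoord.symm (r, f), t) ∈ s} = Set.Ici (√(r * (δ f - r))) := by
    rw [← setOf_pos_and_le_sq hq]
    exact Set.ext fun t => (h hr hf t).trans (and_iff_right hrf)
  rw [fiberVolume, hray, lintegral_Ici_inv_pow_three (sqrt_pos.2 hq), sq_sqrt hq.le,
    ← ENNReal.ofReal_mul hr.le]
  congr 1
  field_simp

theorem lintegral_fiberVolume (h : IsPolarRegion s a ρ δ) (hf : f ∈ Set.Ioo (-π) π)
    (hfa : f ∈ Set.Icc 0 a) (hρ : 0 < ρ f) (hδ : ρ f < δ f) :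
    ∫⁻ r in Set.Ioi (0 : ℝ), ENNReal.ofReal r * fiberVolume s (Complex.polarCoord.symm (r, f)) =
      ENNReal.ofReal ((log (δ f) - log (δ f - ρ f)) / 2) := by
  have hradial : Set.EqOn
      (fun r => ENNReal.ofReal r * fiberVolume s (Complex.polarCoord.symm (r, f)))
      ((Set.Ioc 0 (ρ f)).indicator fun r => ENNReal.ofReal ((2 * (δ f - r))⁻¹)) (Set.Ioi 0) := by
    intro r hr
    by_cases hrρ : r ≤ ρ f
    · rw [Set.indicator_of_mem (show r ∈ Set.Ioc 0 (ρ f) from ⟨hr, hrρ⟩)]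
      exact h.ofReal_mul_fiberVolume hr hf ⟨hfa, hrρ⟩ (hrρ.trans_lt hδ)
    · rw [Set.indicator_of_notMem fun hmem => hrρ hmem.2]
      simp only [h.fiberVolume_eq_zero hr hf fun hmem => hrρ hmem.2, mul_zero]
  rw [setLIntegral_congr_fun measurableSet_Ioi hradial, lintegral_indicator measurableSet_Ioc,
    Measure.restrict_restrict measurableSet_Ioc, Set.inter_eq_left.2 Set.Ioc_subset_Ioi_self,
    lintegral_Ioc_inv_sub hρ hδ]

theorem lintegral_fiberVolume_eq_zero (h : IsPolarRegion s a ρ δ) (hf : f ∈ Set.Ioo (-π) π)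
    (hfa : f ∉ Set.Icc 0 a) :
    ∫⁻ r in Set.Ioi (0 : ℝ), ENNReal.ofReal r * fiberVolume s (Complex.polarCoord.symm (r, f)) =
      0 := by
  refine setLIntegral_eq_zero measurableSet_Ioi fun r hr => ?_
  simp only [h.fiberVolume_eq_zero hr hf fun hmem => hfa hmem.1, mul_zero, Pi.zero_apply]

theorem hyperbolicVolume_eq (h : IsPolarRegion s a ρ δ) (hs : MeasurableSet s)
    (hsU : s ⊆ upperHalfSpace) (ha : a < π) (hρ : ∀ f ∈ Set.Ioo 0 a, 0 < ρ f)
    (hδ : ∀ f ∈ Set.Ioo 0 a, ρ f < δ f) :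
    hyperbolicVolume s =
      ∫⁻ f in Set.Ioo 0 a, ENNReal.ofReal ((log (δ f) - log (δ f - ρ f)) / 2) := by
  set radial : ℝ → ENNReal := fun f => ∫⁻ r in Set.Ioi (0 : ℝ),
    ENNReal.ofReal r * fiberVolume s (Complex.polarCoord.symm (r, f)) with hradial
  have hsub : Set.Icc 0 a ⊆ Set.Ioo (-π) π :=
    fun f hf => ⟨(neg_lt_zero.2 pi_pos).trans_le hf.1, hf.2.trans_lt ha⟩
  have hsupport : Set.EqOn radial ((Set.Icc 0 a).indicator radial) (Set.Ioo (-π) π) := by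
    intro f hf
    by_cases hfa : f ∈ Set.Icc 0 a
    · rw [Set.indicator_of_mem hfa]
    · rw [Set.indicator_of_notMem hfa]
      exact h.lintegral_fiberVolume_eq_zero hf hfa
  rw [hyperbolicVolume_eq_lintegral_polar hs hsU, ← hradial,
    setLIntegral_congr_fun measurableSet_Ioo hsupport, lintegral_indicator measurableSet_Icc,
    Measure.restrict_restrict measurableSet_Icc, Set.inter_eq_left.2 hsub,
    ← restrict_Ioo_eq_restrict_Icc]
  refine setLIntegral_congr_fun measurableSet_Ioo fun f hf => ?_
  have hfa := Set.Ioo_subset_Icc_self hf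
  exact h.lintegral_fiberVolume (hsub hfa) hfa (hρ f hf) (hδ f hf)

end IsPolarRegion

end PolarRegion

section IdealTetrahedron

open MeasureTheory Real

variable {a b c f : ℝ}

theorem isPolarRegion_idealSimplex_thirdVertex (h : IsTriangle a b c) :
    IsPolarRegion (idealSimplex (standardVertices (thirdVertex a b c))) a
      (fun f => sin b / sin (f + b)) (fun f => sin (f + c) / sin c) :=
  fun _ hr _ hf t => mem_idealSimplex_polar_iff h hr hf t

namespace IsTriangle

theorem sin_add_mul_sin_add_sub (h : a + b + c = π) (f : ℝ) :
    sin (f + c) * sin (f + b) - sin b * sin c = sin f * sin (a - f) := by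
  rw [show a - f = π - (f + b + c) by linarith, sin_pi_sub, sin_add (f + b), sin_add, sin_add,
    cos_add]
  linear_combination sin b * sin c * sin_sq_add_cos_sq f

theorem sin_pos_of_mem_Ioo (h : IsTriangle a b c) (hf : f ∈ Set.Ioo 0 a) :
    0 < sin f ∧ 0 < sin (a - f) ∧ 0 < sin (f + b) ∧ 0 < sin (f + c) := by
  obtain ⟨_, hb, hc, hsum⟩ := h
  obtain ⟨hf₀, hfa⟩ := hf
  refine ⟨?_, ?_, ?_, ?_⟩ <;> apply sin_pos_of_pos_of_lt_pi <;> linarith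

theorem sin_div_sub_sin_div (h : IsTriangle a b c) (hf : f ∈ Set.Ioo 0 a) :
    sin (f + c) / sin c - sin b / sin (f + b) =
      sin f * sin (a - f) / (sin c * sin (f + b)) := by
  have hc := h.rotate.rotate.sin_pos.ne'
  have hfb := (h.sin_pos_of_mem_Ioo hf).2.2.1.ne'
  rw [← sin_add_mul_sin_add_sub h.sum_eq]
  field_simp

theorem sin_div_lt_sin_div (h : IsTriangle a b c) (hf : f ∈ Set.Ioo 0 a) :
    sin b / sin (f + b) < sin (f + c) / sin c := by
  obtain ⟨hf₀, haf, hfb, -⟩ := h.sin_pos_of_mem_Ioo hf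
  have hc := h.rotate.rotate.sin_pos
  rw [← sub_pos, h.sin_div_sub_sin_div hf]
  positivity

theorem log_sin_div_sub_log (h : IsTriangle a b c) (hf : f ∈ Set.Ioo 0 a) :
    log (sin (f + c) / sin c) - log (sin (f + c) / sin c - sin b / sin (f + b)) =
      log (sin (f + b)) + log (sin (f + c)) - log (sin f) - log (sin (a - f)) := by
  obtain ⟨hf₀, haf, hfb, hfc⟩ := h.sin_pos_of_mem_Ioo hf
  have hc := h.rotate.rotate.sin_pos
  rw [h.sin_div_sub_sin_div hf, log_div hfc.ne' hc.ne', log_div (by positivity) (by positivity),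
    log_mul hf₀.ne' haf.ne', log_mul hc.ne' hfb.ne']
  ring

theorem half_log_sin_nonneg (h : IsTriangle a b c) (hf : f ∈ Set.Ioo 0 a) :
    0 ≤ (log (sin (f + b)) + log (sin (f + c)) - log (sin f) - log (sin (a - f))) / 2 := by
  have hb : 0 < sin b / sin (f + b) :=
    div_pos h.rotate.sin_pos (h.sin_pos_of_mem_Ioo hf).2.2.1
  have hlt := h.sin_div_lt_sin_div hf
  rw [← h.log_sin_div_sub_log hf]
  exact div_nonneg (sub_nonneg.2 (log_le_log (sub_pos.2 hlt) (by linarith))) two_pos.le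

theorem angleVolume_nonneg (h : IsTriangle a b c) : 0 ≤ angleVolume a b c := by
  rw [← integral_half_log_sin h.sum_eq, intervalIntegral.integral_of_le h.pos₁.le,
    ← restrict_Ioo_eq_restrict_Ioc]
  exact setIntegral_nonneg measurableSet_Ioo fun f hf => h.half_log_sin_nonneg hf

end IsTriangle

theorem hyperbolicVolume_idealSimplex_thirdVertex (h : IsTriangle a b c) :
    hyperbolicVolume (idealSimplex (standardVertices (thirdVertex a b c))) =
      ENNReal.ofReal (angleVolume a b c) := by
  rw [(isPolarRegion_idealSimplex_thirdVertex h).hyperbolicVolume_eq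
    (measurableSet_idealSimplex_standardVertices (thirdVertex_im_pos h)) (fun p hp => hp.1) h.lt_pi
    (fun f hf => div_pos h.rotate.sin_pos (h.sin_pos_of_mem_Ioo hf).2.2.1)
    (fun f hf => h.sin_div_lt_sin_div hf)]
  have hintegrand : Set.EqOn
      (fun f => ENNReal.ofReal ((log (sin (f + c) / sin c) -
        log (sin (f + c) / sin c - sin b / sin (f + b))) / 2))
      (fun f => ENNReal.ofReal ((log (sin (f + b)) + log (sin (f + c)) -
        log (sin f) - log (sin (a - f))) / 2)) (Set.Ioo 0 a) := fun f hf => by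
    simp only [h.log_sin_div_sub_log hf]
  rw [setLIntegral_congr_fun measurableSet_Ioo hintegrand, ← ofReal_integral_eq_lintegral_ofReal,
    restrict_Ioo_eq_restrict_Ioc, ← intervalIntegral.integral_of_le h.pos₁.le,
    integral_half_log_sin h.sum_eq]
  · rw [restrict_Ioo_eq_restrict_Ioc]
    exact (intervalIntegrable_half_log_sin a b c).1
  · filter_upwards [ae_restrict_mem measurableSet_Ioo] with f hf
    exact h.half_log_sin_nonneg hf

theorem simplexVolume_thirdVertex (h : IsTriangle a b c) :
    simplexVolume (standardVertices (thirdVertex a b c)) = angleVolume a b c := by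
  rw [simplexVolume, hyperbolicVolume_idealSimplex_thirdVertex h,
    ENNReal.toReal_ofReal h.angleVolume_nonneg]

end IdealTetrahedron

/-! ## Maximal ideal simplices -/

section Det₂

theorem exists_eq_smul_of_det₂_eq_zero {u w : Fin 2 → ℂ} (hu : u ≠ 0) (h : det₂ u w = 0) :
    ∃ c : ℂ, w = c • u := by
  have hw : ∀ i j, u i * w j = u j * w i := by
    have h₀₁ : u 0 * w 1 = u 1 * w 0 := sub_eq_zero.1 h
    simp only [Fin.forall_fin_two]
    exact ⟨⟨trivial, h₀₁⟩, h₀₁.symm, trivial⟩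
  obtain ⟨i, hi⟩ := Function.ne_iff.1 hu
  refine ⟨w i / u i, funext fun j => ?_⟩
  rw [Pi.smul_apply, smul_eq_mul, div_mul_eq_mul_div, eq_div_iff hi]
  linear_combination hw i j

theorem exists_det₂_ne_zero {u : Fin 2 → ℂ} (hu : u ≠ 0) : ∃ w, det₂ u w ≠ 0 := by
  contrapose! hu
  have h₀ : u 0 = 0 := by simpa [det₂] using hu ![0, 1]
  have h₁ : u 1 = 0 := by simpa [det₂] using hu ![1, 0]
  exact funext fun i => by fin_cases i <;> assumption

end Det₂

section Flat

open MeasureTheory Matrix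
open scoped ComplexConjugate

/-- The nonzero vectors with this property represent the points of `ℝ ∪ {∞} ⊂ ℙ(ℂ²)`. -/
def IsRealPoint (w : Fin 2 → ℂ) : Prop := (w 0 * conj (w 1)).im = 0

theorem IsRealPoint.smul {w : Fin 2 → ℂ} (hw : IsRealPoint w) (c : ℂ) : IsRealPoint (c • w) := by
  have hnorm : c * w 0 * conj (c * w 1) = ((Complex.normSq c : ℝ) : ℂ) * (w 0 * conj (w 1)) := by
    rw [← Complex.mul_conj, map_mul]
    ring
  simp only [IsRealPoint, Pi.smul_apply, smul_eq_mul, hnorm, Complex.im_ofReal_mul]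
  rw [hw, mul_zero]

theorem hyperbolicVolume_real_plane : hyperbolicVolume {p | p.1.im = 0} = 0 := by
  let plane : Submodule ℝ (ℂ × ℝ) := LinearMap.ker (Complex.imLm ∘ₗ LinearMap.fst ℝ ℂ ℝ)
  have hplane : plane ≠ ⊤ := fun h => by
    simpa [plane] using (h ▸ Submodule.mem_top : (Complex.I, (0 : ℝ)) ∈ plane)
  exact (withDensity_absolutelyContinuous _ _).trans Measure.absolutelyContinuous_restrict
    (Measure.addHaar_submodule volume plane hplane)

theorem simplexVolume_eq_zero_of_isRealPoint {v : Fin 4 → Fin 2 → ℂ} (hv : ∀ i, IsRealPoint (v i)) :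
    simplexVolume v = 0 := by
  have hsub : idealSimplex v ⊆ {p | p.1.im = 0} := by
    rintro p ⟨hp, c, -, h⟩
    have hentry := congrArg Complex.im (congrFun (congrFun h 0) 1)
    have hp' : p.2 ≠ 0 := (mem_upperHalfSpace.1 hp).ne'
    have hreal (i : Fin 4) : ((c i : ℂ) * (v i 0 * conj (v i 1))).im = 0 := by
      rw [Complex.im_ofReal_mul, hv i, mul_zero]
    simpa [toHyperboloid, lightVector, Matrix.sum_apply, vecMulVec_apply, -Complex.mul_im,
      Complex.im_ofReal_mul, hreal, hp', -Complex.ofReal_inv] using hentry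
  rw [simplexVolume, measure_mono_null hsub hyperbolicVolume_real_plane, ENNReal.toReal_zero]

theorem simplexVolume_standardVertices_of_im_eq_zero {z : ℂ} (hz : z.im = 0) :
    simplexVolume (standardVertices z) = 0 :=
  simplexVolume_eq_zero_of_isRealPoint fun i => by
    fin_cases i <;> simp [IsRealPoint, standardVertices, hz]

theorem exists_isRealPoint_mulVec_of_det₂_ne_zero {u x : Fin 2 → ℂ} (h : det₂ u x ≠ 0)
    (y : Fin 2 → ℂ) : ∃ g : Matrix (Fin 2) (Fin 2) ℂ, g.det ≠ 0 ∧
      IsRealPoint (g *ᵥ u) ∧ IsRealPoint (g *ᵥ x) ∧ IsRealPoint (g *ᵥ y) := by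
  obtain ⟨α, hα, hreal⟩ : ∃ α : ℂ, α ≠ 0 ∧ (α * (det₂ u y * conj (det₂ x y))).im = 0 := by
    by_cases hd : det₂ u y * conj (det₂ x y) = 0
    · exact ⟨1, one_ne_zero, by rw [hd, mul_zero, Complex.zero_im]⟩
    · exact ⟨_, inv_ne_zero hd, by rw [inv_mul_cancel₀ hd, Complex.one_im]⟩
  let g : Matrix (Fin 2) (Fin 2) ℂ := !![-u 1 * α, u 0 * α; -x 1, x 0]
  have hg (w : Fin 2 → ℂ) : g *ᵥ w = ![α * det₂ u w, det₂ x w] := by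
    ext i
    fin_cases i <;> simp [g, det₂, vecHead, vecTail] <;> ring
  have hself (w : Fin 2 → ℂ) : det₂ w w = 0 := by rw [det₂]; ring
  have hdet : g.det = α * det₂ u x := by
    rw [det_fin_two_of, det₂]
    ring
  refine ⟨g, hdet ▸ mul_ne_zero hα h, ?_, ?_, ?_⟩
  · simp [IsRealPoint, hg, hself]
  · simp [IsRealPoint, hg, hself]
  · simp only [IsRealPoint, hg, cons_val_zero, cons_val_one, cons_val_fin_one]
    rwa [mul_assoc]

theorem exists_isRealPoint_mulVec {u : Fin 2 → ℂ} (hu : u ≠ 0) (x y : Fin 2 → ℂ) :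
    ∃ g : Matrix (Fin 2) (Fin 2) ℂ, g.det ≠ 0 ∧
      IsRealPoint (g *ᵥ u) ∧ IsRealPoint (g *ᵥ x) ∧ IsRealPoint (g *ᵥ y) := by
  by_cases hx : det₂ u x = 0
  · obtain ⟨c, rfl⟩ := exists_eq_smul_of_det₂_eq_zero hu hx
    obtain ⟨w, hw⟩ := exists_det₂_ne_zero hu
    by_cases hy : det₂ u y = 0
    · obtain ⟨d, rfl⟩ := exists_eq_smul_of_det₂_eq_zero hu hy
      obtain ⟨g, hg, hgu, -, -⟩ := exists_isRealPoint_mulVec_of_det₂_ne_zero hw 0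
      exact ⟨g, hg, hgu, by simpa only [mulVec_smul] using hgu.smul c,
        by simpa only [mulVec_smul] using hgu.smul d⟩
    · obtain ⟨g, hg, hgu, hgy, -⟩ := exists_isRealPoint_mulVec_of_det₂_ne_zero hy 0
      exact ⟨g, hg, hgu, by simpa only [mulVec_smul] using hgu.smul c, hgy⟩
  · exact exists_isRealPoint_mulVec_of_det₂_ne_zero hx y

theorem simplexVolume_eq_zero_of_det₂_eq_zero {v : Fin 4 → Fin 2 → ℂ} {i j : Fin 4} (hij : i ≠ j)
    (hi : v i ≠ 0) (h : det₂ (v i) (v j) = 0) : simplexVolume v = 0 := by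
  obtain ⟨k, l, hkl⟩ : ∃ k l, ∀ m, m = i ∨ m = j ∨ m = k ∨ m = l := by
    clear hi h
    decide +revert
  obtain ⟨c, hc⟩ := exists_eq_smul_of_det₂_eq_zero hi h
  obtain ⟨g, hg, hgi, hgk, hgl⟩ := exists_isRealPoint_mulVec hi (v k) (v l)
  have hgj : IsRealPoint (g *ᵥ v j) := by simpa only [hc, mulVec_smul] using hgi.smul c
  rw [← simplexVolume_mulVec hg v]
  refine simplexVolume_eq_zero_of_isRealPoint fun m => ?_
  rcases hkl m with rfl | rfl | rfl | rfl <;> assumption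

end Flat

section Triangle

open Real
open scoped ComplexConjugate

theorem arg_mem_Ioo_of_im_pos {z : ℂ} (hz : 0 < z.im) : z.arg ∈ Set.Ioo 0 π := by
  refine ⟨(Complex.arg_nonneg_iff.2 hz.le).lt_of_ne fun h => hz.ne' ?_,
    Complex.arg_lt_pi_iff.2 (Or.inr hz.ne')⟩
  exact (Complex.arg_eq_zero_iff.1 h.symm).2

theorem mul_im_eq_norm_mul_sin (z w : ℂ) : (z * w).im = ‖z‖ * ‖w‖ * sin (z.arg + w.arg) := by
  rw [Complex.mul_im, ← Complex.norm_mul_cos_arg z, ← Complex.norm_mul_sin_arg z,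
    ← Complex.norm_mul_cos_arg w, ← Complex.norm_mul_sin_arg w, sin_add]
  ring

theorem exists_eq_thirdVertex {z : ℂ} (hz : 0 < z.im) :
    ∃ a b c, IsTriangle a b c ∧ z = thirdVertex a b c := by
  set u : ℂ := 1 - conj z with hu
  have hu_im : u.im = z.im := by simp [hu]
  have hzu : (z * u).im = z.im := by
    simp [hu, mul_sub, Complex.mul_conj, -Complex.mul_im]
  obtain ⟨ha, ha'⟩ := arg_mem_Ioo_of_im_pos hz
  obtain ⟨hb, hb'⟩ := arg_mem_Ioo_of_im_pos (hu_im ▸ hz)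
  have hnu : 0 < ‖u‖ := norm_pos_iff.2 fun h => by simp [h, hz.ne] at hu_im
  have hsum : 0 < sin (z.arg + u.arg) := by
    rw [← hzu, mul_im_eq_norm_mul_sin] at hz
    exact pos_of_mul_pos_right hz (by positivity)
  have hlt : z.arg + u.arg < π := by
    contrapose! hsum
    rw [← neg_nonneg, ← sin_sub_pi]
    exact sin_nonneg_of_nonneg_of_le_pi (by linarith) (by linarith)
  have hratio : sin u.arg / sin (π - (z.arg + u.arg)) = ‖z‖ := by
    rw [sin_pi_sub, div_eq_iff hsum.ne']
    refine mul_left_cancel₀ hnu.ne' ?_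
    rw [Complex.norm_mul_sin_arg, hu_im, ← hzu, mul_im_eq_norm_mul_sin]
    ring
  refine ⟨z.arg, u.arg, π - (z.arg + u.arg), ⟨ha, hb, by linarith, by ring⟩, ?_⟩
  rw [thirdVertex, hratio, Complex.polarCoord_symm_apply]
  simpa only [Complex.ofReal_cos, Complex.ofReal_sin] using
    (Complex.norm_mul_cos_add_sin_mul_I z).symm

/-- The vertex `z` for which the ideal simplex with vertices `∞, 0, 1, z` is regular and positively
oriented. -/
def regularVertex : ℂ := thirdVertex (π / 3) (π / 3) (π / 3)

theorem regularVertex_im_pos : 0 < regularVertex.im := thirdVertex_im_pos isTriangle_pi_div_three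

theorem simplexVolume_regularVertex :
    simplexVolume (standardVertices regularVertex) = angleVolume (π / 3) (π / 3) (π / 3) :=
  simplexVolume_thirdVertex isTriangle_pi_div_three

theorem simplexVolume_regularVertex_pos : 0 < simplexVolume (standardVertices regularVertex) := by
  have h : IsTriangle (π / 2) (π / 4) (π / 4) :=
    ⟨by positivity, by positivity, by positivity, by ring⟩
  rw [simplexVolume_regularVertex]
  exact h.angleVolume_nonneg.trans_lt (angleVolume_lt h fun hne => by linarith [hne.1, pi_pos])

theorem simplexVolume_standardVertices_lt_of_im_pos {z : ℂ} (hz : 0 < z.im)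
    (hne : z ≠ regularVertex) :
    simplexVolume (standardVertices z) < simplexVolume (standardVertices regularVertex) := by
  obtain ⟨a, b, c, h, rfl⟩ := exists_eq_thirdVertex hz
  rw [simplexVolume_thirdVertex h, simplexVolume_regularVertex]
  refine angleVolume_lt h ?_
  rintro ⟨rfl, rfl⟩
  obtain rfl : c = π / 3 := by linarith [h.sum_eq]
  exact hne rfl

end Triangle

section CrossRatio

open Matrix
open scoped ComplexConjugate

theorem simplexVolume_standardVertices_conj (z : ℂ) :
    simplexVolume (standardVertices (conj z)) = simplexVolume (standardVertices z) := by
  rw [← simplexVolume_conj]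
  congr 1
  ext i j
  fin_cases i <;> fin_cases j <;> simp [standardVertices]

theorem simplexVolume_standardVertices_lt {z : ℂ} (h : z ≠ regularVertex)
    (h' : z ≠ conj regularVertex) :
    simplexVolume (standardVertices z) < simplexVolume (standardVertices regularVertex) := by
  rcases lt_trichotomy z.im 0 with hz | hz | hz
  · rw [← simplexVolume_standardVertices_conj]
    refine simplexVolume_standardVertices_lt_of_im_pos (by simpa using hz) fun heq => h' ?_
    rw [← heq, Complex.conj_conj]
  · rw [simplexVolume_standardVertices_of_im_eq_zero hz]
    exact simplexVolume_regularVertex_pos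
  · exact simplexVolume_standardVertices_lt_of_im_pos hz h

theorem simplexVolume_standardVertices_le (z : ℂ) :
    simplexVolume (standardVertices z) ≤ simplexVolume (standardVertices regularVertex) := by
  by_cases h : z = regularVertex
  · rw [h]
  by_cases h' : z = conj regularVertex
  · rw [h', simplexVolume_standardVertices_conj]
  exact (simplexVolume_standardVertices_lt h h').le

variable {v : Fin 4 → Fin 2 → ℂ}

theorem simplexVolume_eq_standardVertices (hv : Pairwise fun i j => det₂ (v i) (v j) ≠ 0) :
    simplexVolume v = simplexVolume (standardVertices (crossRatio v)) := by
  have h₀₁ : det₂ (v 0) (v 1) ≠ 0 := hv (by decide)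
  have h₀₂ : det₂ (v 0) (v 2) ≠ 0 := hv (by decide)
  have h₀₃ : det₂ (v 0) (v 3) ≠ 0 := hv (by decide)
  have h₁₂ : det₂ (v 1) (v 2) ≠ 0 := hv (by decide)
  let g : Matrix (Fin 2) (Fin 2) ℂ :=
    !![-v 1 1 / det₂ (v 1) (v 2), v 1 0 / det₂ (v 1) (v 2);
      -v 0 1 / det₂ (v 0) (v 2), v 0 0 / det₂ (v 0) (v 2)]
  let c : Fin 4 → ℂ := ![-det₂ (v 0) (v 1) / det₂ (v 1) (v 2), det₂ (v 0) (v 1) / det₂ (v 0) (v 2),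
    1, det₂ (v 0) (v 3) / det₂ (v 0) (v 2)]
  have hdet : g.det = -det₂ (v 0) (v 1) / (det₂ (v 1) (v 2) * det₂ (v 0) (v 2)) := by
    rw [det_fin_two_of]
    field_simp
    rw [det₂]
    ring
  have hg : g.det ≠ 0 := hdet ▸ div_ne_zero (neg_ne_zero.2 h₀₁) (mul_ne_zero h₁₂ h₀₂)
  have hc : ∀ i, c i ≠ 0 := forall_fin_four.2 ⟨div_ne_zero (neg_ne_zero.2 h₀₁) h₁₂,
    div_ne_zero h₀₁ h₀₂, one_ne_zero, div_ne_zero h₀₃ h₀₂⟩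
  have hgv : (fun i => g *ᵥ v i) = fun i => c i • standardVertices (crossRatio v) i := by
    ext i j
    fin_cases i <;> fin_cases j <;>
      simp [g, c, standardVertices, crossRatio, vecHead, vecTail] <;> field_simp <;>
      simp only [det₂] <;> ring
  rw [← simplexVolume_mulVec hg v, hgv, simplexVolume_smul _ hc]

theorem simplexVolume_eq_zero_or_eq_standardVertices (hv : ∀ i, v i ≠ 0) :
    simplexVolume v = 0 ∨ simplexVolume v = simplexVolume (standardVertices (crossRatio v)) := by
  by_cases h : Pairwise fun i j => det₂ (v i) (v j) ≠ 0
  · exact .inr (simplexVolume_eq_standardVertices h)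
  · simp only [Pairwise, not_forall, not_not] at h
    obtain ⟨i, j, hij, hdet⟩ := h
    exact .inl (simplexVolume_eq_zero_of_det₂_eq_zero hij (hv i) hdet)

theorem v₃_eq_simplexVolume_regularVertex :
    v₃ = simplexVolume (standardVertices regularVertex) := by
  refine IsGreatest.csSup_eq ⟨⟨standardVertices regularVertex, fun i => ?_, rfl⟩, ?_⟩
  · fin_cases i <;> simp [standardVertices]
  · rintro r ⟨v, hv, rfl⟩
    rcases simplexVolume_eq_zero_or_eq_standardVertices hv with h | h
    · exact h.trans_le simplexVolume_regularVertex_pos.le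
    · exact h.trans_le (simplexVolume_standardVertices_le _)

theorem v₃_pos : 0 < v₃ :=
  v₃_eq_simplexVolume_regularVertex ▸ simplexVolume_regularVertex_pos

theorem simplexVolume_le_v₃ (hv : ∀ i, v i ≠ 0) : simplexVolume v ≤ v₃ := by
  rw [v₃_eq_simplexVolume_regularVertex]
  rcases simplexVolume_eq_zero_or_eq_standardVertices hv with h | h
  · exact h.trans_le simplexVolume_regularVertex_pos.le
  · exact h.trans_le (simplexVolume_standardVertices_le _)

theorem crossRatio_of_v₃_le_simplexVolume (hv : ∀ i, v i ≠ 0) (h : v₃ ≤ simplexVolume v) :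
    crossRatio v = regularVertex ∨ crossRatio v = conj regularVertex := by
  by_contra! hne
  rcases simplexVolume_eq_zero_or_eq_standardVertices hv with h₀ | hstd
  · exact (h₀ ▸ h).not_gt v₃_pos
  · rw [hstd, v₃_eq_simplexVolume_regularVertex] at h
    exact h.not_gt (simplexVolume_standardVertices_lt hne.1 hne.2)

theorem simplexVolume_nonneg (v : Fin 4 → Fin 2 → ℂ) : 0 ≤ simplexVolume v :=
  ENNReal.toReal_nonneg

theorem abs_volH3_le_simplexVolume (v : Fin 4 → Fin 2 → ℂ) : |volH3 v| ≤ simplexVolume v := by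
  have hsign : |Real.sign (crossRatio v).im| ≤ 1 := by
    rcases Real.sign_apply_eq (crossRatio v).im with h | h | h <;> simp [h]
  rw [volH3, abs_mul, abs_of_nonneg (simplexVolume_nonneg v)]
  exact mul_le_of_le_one_left (simplexVolume_nonneg v) hsign

theorem det₂_ne_zero_of_volH3_ne_zero (hv : ∀ i, v i ≠ 0) (h : volH3 v ≠ 0) :
    Pairwise fun i j => det₂ (v i) (v j) ≠ 0 := fun i j hij hdet =>
  h (by rw [volH3, simplexVolume_eq_zero_of_det₂_eq_zero hij (hv i) hdet, mul_zero])

theorem crossRatio_eq_of_volH3_eq {v' : Fin 4 → Fin 2 → ℂ} (hv : ∀ i, v i ≠ 0)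
    (hv' : ∀ i, v' i ≠ 0) (hmax : |volH3 v| = v₃) (heq : volH3 v' = volH3 v) :
    crossRatio v' = crossRatio v := by
  have hcr := crossRatio_of_v₃_le_simplexVolume hv (hmax ▸ abs_volH3_le_simplexVolume v)
  have hcr' := crossRatio_of_v₃_le_simplexVolume hv'
    (hmax ▸ heq ▸ abs_volH3_le_simplexVolume v')
  have hsign : ∀ {w : Fin 4 → Fin 2 → ℂ}, crossRatio w = regularVertex → 0 ≤ volH3 w := by
    intro w hw
    rw [volH3, hw, Real.sign_of_pos regularVertex_im_pos, one_mul]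
    exact simplexVolume_nonneg w
  have hsign' : ∀ {w : Fin 4 → Fin 2 → ℂ}, crossRatio w = conj regularVertex → volH3 w ≤ 0 := by
    intro w hw
    rw [volH3, hw, Real.sign_of_neg (by simpa using regularVertex_im_pos), neg_one_mul]
    exact neg_nonpos.2 (simplexVolume_nonneg w)
  have hne : volH3 v ≠ 0 := abs_pos.1 (hmax ▸ v₃_pos)
  rcases hcr with h | h <;> rcases hcr' with h' | h'
  · rw [h, h']
  · exact absurd ((heq ▸ hsign' h').antisymm (hsign h)) hne
  · exact absurd ((hsign' h).antisymm (heq ▸ hsign h')) hne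
  · rw [h, h']

theorem det₂_eq_zero_of_crossRatio_eq {v' : Fin 4 → Fin 2 → ℂ}
    (hv : Pairwise fun i j => det₂ (v i) (v j) ≠ 0)
    (hv' : Pairwise fun i j => det₂ (v' i) (v' j) ≠ 0) (hagree : ∀ i, i ≠ 3 → v' i = v i)
    (h : crossRatio v' = crossRatio v) : det₂ (v 3) (v' 3) = 0 := by
  have h₀₁ : det₂ (v 0) (v 1) ≠ 0 := hv (by decide)
  have h₀₂ : det₂ (v 0) (v 2) ≠ 0 := hv (by decide)
  have h₀₃ : det₂ (v 0) (v 3) ≠ 0 := hv (by decide)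
  have h₁₂ : det₂ (v 1) (v 2) ≠ 0 := hv (by decide)
  have h₀₃' : det₂ (v' 0) (v' 3) ≠ 0 := hv' (by decide)
  rw [hagree 0 (by decide)] at h₀₃'
  rw [crossRatio, crossRatio, hagree 0 (by decide), hagree 1 (by decide), hagree 2 (by decide),
    div_eq_div_iff (mul_ne_zero h₀₃' h₁₂) (mul_ne_zero h₀₃ h₁₂)] at h
  have hratio : det₂ (v 1) (v 3) * det₂ (v 0) (v' 3) = det₂ (v 1) (v' 3) * det₂ (v 0) (v 3) :=
    mul_left_cancel₀ (mul_ne_zero h₀₂ h₁₂) (by linear_combination -h)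
  refine (mul_eq_zero.1 ?_).resolve_left h₀₁
  simp only [det₂] at hratio ⊢
  linear_combination -hratio

end CrossRatio

/-! ## The terms of the sum -/

section Terms

open Module

section Vol

variable {V : Type*} [AddCommGroup V] [Module ℂ V] [FiniteDimensional ℂ V] {x x' : Fin 4 → V}

theorem abs_Vol_le_v₃ (x : Fin 4 → V) : |Vol V x| ≤ v₃ := by
  unfold Vol
  split_ifs with hV hx
  · exact (abs_volH3_le_simplexVolume _).trans (simplexVolume_le_v₃ fun i =>
      (LinearEquiv.map_ne_zero_iff _).2 (hx i))
  · simpa only [abs_zero] using v₃_pos.le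
  · simpa only [abs_zero] using v₃_pos.le

theorem exists_equiv_of_Vol_ne_zero (h : Vol V x ≠ 0) :
    ∃ hV : finrank ℂ V = 2, (∀ i, x i ≠ 0) ∧
      Vol V x = volH3 fun i => (finBasisOfFinrankEq ℂ V hV).equivFun (x i) := by
  unfold Vol at h ⊢
  split_ifs at h with hV hx
  · exact ⟨hV, hx, by rw [dif_pos hV, if_pos hx]⟩
  · exact absurd rfl h
  · exact absurd rfl h

theorem finrank_eq_two_of_Vol_ne_zero (h : Vol V x ≠ 0) : finrank ℂ V = 2 :=
  (exists_equiv_of_Vol_ne_zero h).1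

theorem linearIndependent_pair_of_det₂_ne_zero {u w : Fin 2 → ℂ} (h : det₂ u w ≠ 0) :
    LinearIndependent ℂ ![u, w] := by
  have hu : u ≠ 0 := fun hu => h (by simp only [hu, det₂, Pi.zero_apply, zero_mul, sub_zero])
  refine (LinearIndependent.pair_iff' hu).2 fun c hc => h ?_
  rw [← hc, det₂, Pi.smul_apply, Pi.smul_apply, smul_eq_mul, smul_eq_mul]
  ring

theorem linearIndependent_pair_of_Vol_ne_zero (h : Vol V x ≠ 0) :
    Pairwise fun i j => LinearIndependent ℂ ![x i, x j] := by
  intro i j hij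
  obtain ⟨hV, hx, hvol⟩ := exists_equiv_of_Vol_ne_zero h
  let e := (finBasisOfFinrankEq ℂ V hV).equivFun
  have hdet : det₂ (e (x i)) (e (x j)) ≠ 0 :=
    det₂_ne_zero_of_volH3_ne_zero (fun i => (LinearEquiv.map_ne_zero_iff e).2 (hx i))
      (hvol ▸ h) hij
  refine LinearIndependent.of_comp (e : V →ₗ[ℂ] Fin 2 → ℂ) ?_
  convert linearIndependent_pair_of_det₂_ne_zero hdet using 1
  funext k
  fin_cases k <;> rfl

theorem exists_eq_smul_of_Vol_eq (hagree : ∀ i, i ≠ 3 → x' i = x i) (hmax : |Vol V x| = v₃)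
    (heq : Vol V x' = Vol V x) : ∃ k : ℂ, x' 3 = k • x 3 := by
  have hne : Vol V x ≠ 0 := abs_pos.1 (hmax ▸ v₃_pos)
  obtain ⟨hV, hx, hvol⟩ := exists_equiv_of_Vol_ne_zero hne
  obtain ⟨_, hx', hvol'⟩ := exists_equiv_of_Vol_ne_zero (heq ▸ hne)
  let e := (finBasisOfFinrankEq ℂ V hV).equivFun
  have hz : ∀ i, e (x i) ≠ 0 := fun i => (LinearEquiv.map_ne_zero_iff e).2 (hx i)
  have hz' : ∀ i, e (x' i) ≠ 0 := fun i => (LinearEquiv.map_ne_zero_iff e).2 (hx' i)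
  have hcross : crossRatio (fun i => e (x' i)) = crossRatio fun i => e (x i) :=
    crossRatio_eq_of_volH3_eq hz hz' (hvol ▸ hmax) (hvol' ▸ hvol ▸ heq)
  have hdet : det₂ (e (x 3)) (e (x' 3)) = 0 :=
    det₂_eq_zero_of_crossRatio_eq (det₂_ne_zero_of_volH3_ne_zero hz (hvol ▸ hne))
      (det₂_ne_zero_of_volH3_ne_zero hz' (hvol' ▸ heq ▸ hne))
      (fun i hi => congrArg e (hagree i hi)) hcross
  obtain ⟨k, hk⟩ := exists_eq_smul_of_det₂_eq_zero (hz 3) hdet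
  exact ⟨k, e.injective (by rw [hk, map_smul])⟩

theorem exists_sub_smul_mem_of_Vol_eq {U W : Submodule ℂ V} (hx : ∀ i, x i ∈ U)
    (hx' : ∀ i, x' i ∈ U) (hagree : ∀ i, i ≠ 3 → x' i = x i)
    (hmax : |Vol (U ⧸ W.submoduleOf U) fun i => Submodule.Quotient.mk ⟨x i, hx i⟩| = v₃)
    (heq : Vol (U ⧸ W.submoduleOf U) (fun i => Submodule.Quotient.mk ⟨x' i, hx' i⟩) =
      Vol (U ⧸ W.submoduleOf U) fun i => Submodule.Quotient.mk ⟨x i, hx i⟩) :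
    ∃ k : ℂ, x' 3 - k • x 3 ∈ W := by
  obtain ⟨k, hk⟩ := exists_eq_smul_of_Vol_eq
    (fun i hi => congrArg Submodule.Quotient.mk (Subtype.ext (hagree i hi))) hmax heq
  exact ⟨k, (Submodule.Quotient.eq (W.submoduleOf U) (y := k • ⟨x 3, hx 3⟩)).1 hk⟩

end Vol

variable {n : ℕ} {F F' : Fin 4 → AffineFlag n} {J J' : Fin 4 → Fin n}

/-- The contribution of the multi-index `J` to `affineB F`. -/
def term (F : Fin 4 → AffineFlag n) (J : Fin 4 → Fin n) : ℝ :=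
  Vol (spanQuotient F J) (quotientVec F J)

/-- The condition on a multi-index under which the vectors span a plane in general position modulo
the smaller flag members; by `isNondegenerate_of_term_ne_zero`, all nonzero terms satisfy it. -/
structure IsNondegenerate (F : Fin 4 → AffineFlag n) (J : Fin 4 → Fin n) : Prop where
  finrank_quotient : finrank ℂ (spanQuotient F J) = 2
  linearIndependent_pair :
    Pairwise fun i j => LinearIndependent ℂ ![quotientVec F J i, quotientVec F J j]

theorem isNondegenerate_of_term_ne_zero (h : term F J ≠ 0) : IsNondegenerate F J where
  finrank_quotient := finrank_eq_two_of_Vol_ne_zero h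
  linearIndependent_pair := linearIndependent_pair_of_Vol_ne_zero h

theorem lowerSpan_le_upperSpan (F : Fin 4 → AffineFlag n) (J : Fin 4 → Fin n) :
    lowerSpan F J ≤ upperSpan F J :=
  iSup_mono fun i => (F i).monotone_subspace (Fin.castSucc_lt_succ (i := J i)).le

theorem quotientVec_combination (F : Fin 4 → AffineFlag n) (J : Fin 4 → Fin n) (i j : Fin 4)
    (a b : ℂ) :
    a • quotientVec F J i + b • quotientVec F J j = Submodule.Quotient.mk
      ⟨a • (F i).vec (J i) + b • (F j).vec (J j), add_mem
        (Submodule.smul_mem _ _ (vec_mem_upperSpan F J i))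
        (Submodule.smul_mem _ _ (vec_mem_upperSpan F J j))⟩ := rfl

namespace IsNondegenerate

variable {i j : Fin 4}

theorem eq_zero_of_combination_mem (h : IsNondegenerate F J) (hij : i ≠ j) {a b : ℂ}
    (hab : a • (F i).vec (J i) + b • (F j).vec (J j) ∈ lowerSpan F J) : a = 0 ∧ b = 0 := by
  refine LinearIndependent.pair_iff.1 (h.linearIndependent_pair hij) a b ?_
  rw [quotientVec_combination, Submodule.Quotient.mk_eq_zero]
  exact hab

theorem vec_notMem (h : IsNondegenerate F J) (i : Fin 4) :
    (F i).vec (J i) ∉ lowerSpan F J := by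
  intro hi
  obtain ⟨j, hij⟩ : ∃ j, i ≠ j := (exists_ne i).imp fun _ => Ne.symm
  have hab : (1 : ℂ) • (F i).vec (J i) + (0 : ℂ) • (F j).vec (J j) ∈ lowerSpan F J := by
    rwa [one_smul, zero_smul, add_zero]
  exact one_ne_zero (h.eq_zero_of_combination_mem hij hab).1

theorem exists_sub_combination_mem (h : IsNondegenerate F J) (hij : i ≠ j) {x : Fin n → ℂ}
    (hx : x ∈ upperSpan F J) :
    ∃ a b : ℂ, x - (a • (F i).vec (J i) + b • (F j).vec (J j)) ∈ lowerSpan F J := by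
  have htop : Submodule.span ℂ {quotientVec F J i, quotientVec F J j} = ⊤ := by
    rw [← Matrix.range_cons_cons_empty _ _ ![]]
    exact (h.linearIndependent_pair hij).span_eq_top_of_card_eq_finrank
      (by rw [Fintype.card_fin, h.finrank_quotient])
  have hmem : (Submodule.Quotient.mk ⟨x, hx⟩ : spanQuotient F J) ∈
      Submodule.span ℂ {quotientVec F J i, quotientVec F J j} := htop ▸ Submodule.mem_top
  obtain ⟨a, b, hab⟩ := Submodule.mem_span_pair.1 hmem
  rw [quotientVec_combination] at hab
  exact ⟨a, b, (Submodule.Quotient.eq ((lowerSpan F J).submoduleOf (upperSpan F J))).1 hab.symm⟩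

theorem finrank_lowerSpan_add_two_le (h : IsNondegenerate F J) :
    finrank ℂ (lowerSpan F J) + 2 ≤ n := by
  have hquot := Submodule.finrank_quotient_add_finrank
    ((lowerSpan F J).submoduleOf (upperSpan F J))
  rw [h.finrank_quotient,
    (Submodule.submoduleOfEquivOfLe (lowerSpan_le_upperSpan F J)).finrank_eq] at hquot
  have hle := Submodule.finrank_le (upperSpan F J)
  rw [finrank_fin_fun] at hle
  omega

theorem upperSpan_eq (h : IsNondegenerate F J) (hij : i ≠ j) :
    upperSpan F J = lowerSpan F J ⊔ Submodule.span ℂ {(F i).vec (J i), (F j).vec (J j)} := by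
  apply le_antisymm
  · intro x hx
    obtain ⟨a, b, hab⟩ := h.exists_sub_combination_mem hij hx
    rw [← sub_add_cancel x (a • (F i).vec (J i) + b • (F j).vec (J j))]
    exact Submodule.add_mem_sup hab (Submodule.mem_span_pair.2 ⟨a, b, rfl⟩)
  · refine sup_le (lowerSpan_le_upperSpan F J) (Submodule.span_le.2 ?_)
    rintro x (rfl | rfl)
    · exact vec_mem_upperSpan F J i
    · exact vec_mem_upperSpan F J j

end IsNondegenerate

theorem term_eq_Vol {U W : Submodule ℂ (Fin n → ℂ)} (hU : upperSpan F J = U)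
    (hW : lowerSpan F J = W) :
    term F J = Vol (U ⧸ W.submoduleOf U) fun i =>
      Submodule.Quotient.mk ⟨(F i).vec (J i), hU ▸ vec_mem_upperSpan F J i⟩ := by
  subst hU hW
  rfl

theorem exists_sub_smul_mem_lowerSpan (hF : ∀ i, i ≠ 3 → F' i = F i)
    (hlow : lowerSpan F' J = lowerSpan F J) (hup : upperSpan F' J = upperSpan F J)
    (hmax : |term F J| = v₃) (heq : term F' J = term F J) :
    ∃ k : ℂ, (F' 3).vec (J 3) - k • (F 3).vec (J 3) ∈ lowerSpan F J := by
  rw [term_eq_Vol hup hlow] at heq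
  exact exists_sub_smul_mem_of_Vol_eq (x' := fun i => (F' i).vec (J i)) (vec_mem_upperSpan F J)
    (fun i => hup ▸ vec_mem_upperSpan F' J i) (fun i hi => by rw [hF i hi]) hmax heq

/-! ## Counting the nonzero terms -/

namespace AffineFlag

theorem vec_mem_of_lt (A : AffineFlag n) {j k : Fin n} (h : j < k) :
    A.vec j ∈ A.subspace k.castSucc := by
  have hj : A.vec j ∈ A.subspace j.succ := by
    rw [A.subspace_succ]
    exact Submodule.mem_sup_left (Submodule.mem_span_singleton_self _)
  exact A.monotone_subspace (Fin.succ_le_castSucc_iff.2 h) hj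

theorem sup_subspace_le_sup_subspace (A : AffineFlag n) (G : Submodule ℂ (Fin n → ℂ))
    {i j : Fin n} (h : i ≤ j) : G ⊔ A.subspace i.castSucc ≤ G ⊔ A.subspace j.castSucc :=
  sup_le_sup_left (A.monotone_subspace (Fin.castSucc_le_castSucc_iff.2 h)) G

theorem eq_of_finrank_sup_eq (A : AffineFlag n) {G : Submodule ℂ (Fin n → ℂ)} {i j : Fin n}
    (hi : A.vec i ∉ G ⊔ A.subspace i.castSucc) (hj : A.vec j ∉ G ⊔ A.subspace j.castSucc)
    (h : finrank ℂ ↥(G ⊔ A.subspace i.castSucc) = finrank ℂ ↥(G ⊔ A.subspace j.castSucc)) :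
    i = j := by
  wlog hij : i ≤ j generalizing i j
  · exact (this hj hi h.symm (le_of_not_ge hij)).symm
  refine hij.eq_of_not_lt fun hlt => hi ?_
  rw [Submodule.eq_of_le_of_finrank_eq (A.sup_subspace_le_sup_subspace G hij) h]
  exact Submodule.mem_sup_right (A.vec_mem_of_lt hlt)

end AffineFlag

/-- The partial span `⟨F₃^{j₃}, F₀^{j₀}⟩`. The flag `3` comes first because it is the one that is
reconstructed from the others. -/
def span₂ (F : Fin 4 → AffineFlag n) (J : Fin 4 → Fin n) : Submodule ℂ (Fin n → ℂ) :=
  (F 3).subspace (J 3).castSucc ⊔ (F 0).subspace (J 0).castSucc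

/-- The partial span `⟨F₃^{j₃}, F₀^{j₀}, F₁^{j₁}⟩`. -/
def span₃ (F : Fin 4 → AffineFlag n) (J : Fin 4 → Fin n) : Submodule ℂ (Fin n → ℂ) :=
  span₂ F J ⊔ (F 1).subspace (J 1).castSucc

theorem lowerSpan_eq (F : Fin 4 → AffineFlag n) (J : Fin 4 → Fin n) :
    lowerSpan F J = span₃ F J ⊔ (F 2).subspace (J 2).castSucc := by
  apply le_antisymm
  · refine iSup_le fun i => ?_
    fin_cases i
    · exact (le_sup_right.trans le_sup_left).trans le_sup_left
    · exact le_sup_right.trans le_sup_left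
    · exact le_sup_right
    · exact (le_sup_left.trans le_sup_left).trans le_sup_left
  · have h := fun i => le_iSup (fun i => (F i).subspace (J i).castSucc) i
    exact sup_le (sup_le (sup_le (h 3) (h 0)) (h 1)) (h 2)

theorem span₃_le_lowerSpan (F : Fin 4 → AffineFlag n) (J : Fin 4 → Fin n) :
    span₃ F J ≤ lowerSpan F J :=
  lowerSpan_eq F J ▸ le_sup_left

theorem span₂_le_lowerSpan (F : Fin 4 → AffineFlag n) (J : Fin 4 → Fin n) :
    span₂ F J ≤ lowerSpan F J :=
  le_sup_left.trans (span₃_le_lowerSpan F J)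

theorem lowerSpan_congr (hF : ∀ i, i ≠ 3 → F' i = F i)
    (h3 : (F' 3).subspace (J 3).castSucc = (F 3).subspace (J 3).castSucc) :
    lowerSpan F' J = lowerSpan F J := by
  refine iSup_congr fun i => ?_
  rcases eq_or_ne i 3 with rfl | hi
  · exact h3
  · rw [hF i hi]

theorem IsNondegenerate.not_lt_of_span₃_eq (h : IsNondegenerate F J) (h' : IsNondegenerate F' J')
    (hF : ∀ i, i ≠ 3 → F' i = F i) (h0 : J' 0 = J 0) (h1 : J' 1 = J 1)
    (hspan : span₃ F' J' = span₃ F J) : ¬ J 2 < J' 2 := by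
  intro hlt
  have hle : lowerSpan F J ≤ lowerSpan F' J' := by
    rw [lowerSpan_eq, lowerSpan_eq, hspan, hF 2 (by decide)]
    exact (F 2).sup_subspace_le_sup_subspace _ hlt.le
  have hmem : (F 2).vec (J 2) ∈ lowerSpan F' J' := by
    rw [lowerSpan_eq, hF 2 (by decide)]
    exact Submodule.mem_sup_right ((F 2).vec_mem_of_lt hlt)
  obtain ⟨a, b, hab⟩ := h.exists_sub_combination_mem (i := 0) (j := 1) (by decide)
    (vec_mem_upperSpan F J 2)
  have hmem' : a • (F' 0).vec (J' 0) + b • (F' 1).vec (J' 1) ∈ lowerSpan F' J' := by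
    rw [hF 0 (by decide), hF 1 (by decide), h0, h1]
    simpa only [sub_sub_cancel] using sub_mem hmem (hle hab)
  obtain ⟨rfl, rfl⟩ := h'.eq_zero_of_combination_mem (by decide) hmem'
  rw [zero_smul, zero_smul, add_zero, sub_zero] at hab
  exact h.vec_notMem 2 hab

theorem IsNondegenerate.index_eq (h : IsNondegenerate F J) (h' : IsNondegenerate F' J')
    (hF : ∀ i, i ≠ 3 → F' i = F i) (hJ : J' 3 = J 3)
    (h3 : (F' 3).subspace (J 3).castSucc = (F 3).subspace (J 3).castSucc)
    (hd₂ : finrank ℂ (span₂ F' J') = finrank ℂ (span₂ F J))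
    (hd₃ : finrank ℂ (span₃ F' J') = finrank ℂ (span₃ F J)) : J' = J := by
  have hspan₂ : span₂ F' J' = (F 3).subspace (J 3).castSucc ⊔ (F 0).subspace (J' 0).castSucc := by
    rw [span₂, hJ, h3, hF 0 (by decide)]
  have h0 : J' 0 = J 0 := (F 0).eq_of_finrank_sup_eq
    (fun hv => h'.vec_notMem 0 (span₂_le_lowerSpan F' J' (by rwa [hspan₂, hF 0 (by decide)])))
    (fun hv => h.vec_notMem 0 (span₂_le_lowerSpan F J hv)) (hspan₂ ▸ hd₂)
  have hspan₃ : span₃ F' J' = span₂ F J ⊔ (F 1).subspace (J' 1).castSucc := by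
    rw [span₃, hspan₂, h0, hF 1 (by decide), span₂]
  have h1 : J' 1 = J 1 := (F 1).eq_of_finrank_sup_eq
    (fun hv => h'.vec_notMem 1 (span₃_le_lowerSpan F' J' (by rwa [hspan₃, hF 1 (by decide)])))
    (fun hv => h.vec_notMem 1 (span₃_le_lowerSpan F J hv)) (hspan₃ ▸ hd₃)
  have hspan : span₃ F' J' = span₃ F J := by rw [hspan₃, h1, span₃]
  have h2 : J' 2 = J 2 := le_antisymm
    (not_lt.1 (h.not_lt_of_span₃_eq h' hF h0 h1 hspan))
    (not_lt.1 (h'.not_lt_of_span₃_eq h (fun i hi => (hF i hi).symm) h0.symm h1.symm hspan.symm))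
  exact funext (forall_fin_four.2 ⟨h0, h1, h2, hJ⟩)

/-- The triples `(d₃, d₂, d₁)` of natural numbers with `d₁ ≤ d₂ ≤ d₃ < m`. -/
def dimensionTriples (m : ℕ) : Finset (Σ _ : ℕ, Σ _ : ℕ, ℕ) :=
  (Finset.range m).sigma fun d₃ => (Finset.range (d₃ + 1)).sigma fun d₂ => Finset.range (d₂ + 1)

theorem card_dimensionTriples (m : ℕ) : (dimensionTriples m).card = (m + 2).choose 3 := by
  have hsum : ∀ d : ℕ, ∑ x ∈ Finset.range (d + 1), (x + 1) = (d + 2).choose 2 := fun d => by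
    simpa only [Nat.choose_one_right] using Nat.sum_range_add_choose d 1
  simp only [dimensionTriples, Finset.card_sigma, Finset.card_range, hsum]
  cases m with
  | zero => rfl
  | succ m => exact Nat.sum_range_add_choose m 2

theorem cast_card_dimensionTriples (n : ℕ) :
    ((dimensionTriples (n - 1)).card : ℝ) = n * (n ^ 2 - 1) / 6 := by
  rw [card_dimensionTriples]
  cases n with
  | zero => norm_num [Nat.choose]
  | succ m =>
    rw [Nat.add_sub_cancel, Nat.cast_choose_eq_ascPochhammer_div]
    norm_num [ascPochhammer_succ_eval, Nat.factorial]
    ring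

open Classical in
/-- The multi-indices of the nonzero terms. -/
def support (F : Fin 4 → AffineFlag n) : Finset (Fin 4 → Fin n) :=
  Finset.univ.filter fun J => term F J ≠ 0

theorem isNondegenerate_of_mem_support (hJ : J ∈ support F) : IsNondegenerate F J :=
  isNondegenerate_of_term_ne_zero (Finset.mem_filter.1 hJ).2

theorem affineB_eq_sum_support (F : Fin 4 → AffineFlag n) :
    affineB F = ∑ J ∈ support F, term F J := by
  classical
  rw [support, Finset.sum_filter_ne_zero]
  rfl

/-- The dimensions of the partial spans `⟨F₃^{j₃}, F₀^{j₀}, F₁^{j₁}⟩`, `⟨F₃^{j₃}, F₀^{j₀}⟩` and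
`F₃^{j₃}`. -/
def dimensions (F : Fin 4 → AffineFlag n) (J : Fin 4 → Fin n) : Σ _ : ℕ, Σ _ : ℕ, ℕ :=
  ⟨finrank ℂ (span₃ F J), finrank ℂ (span₂ F J), J 3⟩

theorem val_le_finrank_span₂ (F : Fin 4 → AffineFlag n) (J : Fin 4 → Fin n) :
    (J 3 : ℕ) ≤ finrank ℂ (span₂ F J) := by
  have h : finrank ℂ ((F 3).subspace (J 3).castSucc) ≤ finrank ℂ (span₂ F J) :=
    Submodule.finrank_mono le_sup_left
  rwa [(F 3).finrank_subspace, Fin.val_castSucc] at h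

theorem dimensions_mem (hJ : J ∈ support F) : dimensions F J ∈ dimensionTriples (n - 1) := by
  have hn := (isNondegenerate_of_mem_support hJ).finrank_lowerSpan_add_two_le
  have h₃ := Submodule.finrank_mono (span₃_le_lowerSpan F J)
  have h₂ : finrank ℂ (span₂ F J) ≤ finrank ℂ (span₃ F J) := Submodule.finrank_mono le_sup_left
  have h₁ := val_le_finrank_span₂ F J
  simp only [dimensionTriples, dimensions, Finset.mem_sigma, Finset.mem_range]
  omega

theorem dimensions_injOn (F : Fin 4 → AffineFlag n) : Set.InjOn (dimensions F) (support F) := by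
  intro J hJ J' hJ' h
  simp only [dimensions, Sigma.mk.injEq, heq_eq_eq] at h
  obtain ⟨hd₃, hd₂, hd₁⟩ := h
  exact (isNondegenerate_of_mem_support hJ').index_eq (isNondegenerate_of_mem_support hJ)
    (fun _ _ => rfl) (Fin.ext hd₁) rfl hd₂ hd₃

theorem card_eq_and_forall_eq_of_sum_eq {ι : Type*} {s : Finset ι} {t : ι → ℝ} {N c : ℝ}
    (hc : 0 < c) (hs : (s.card : ℝ) ≤ N) (ht : ∀ i ∈ s, t i ≤ c) (h : ∑ i ∈ s, t i = N * c) :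
    (s.card : ℝ) = N ∧ ∀ i ∈ s, t i = c := by
  have hsum : ∑ i ∈ s, t i ≤ s.card * c := by
    simpa only [nsmul_eq_mul] using Finset.sum_le_card_nsmul s t c ht
  have hcard : (s.card : ℝ) = N := le_antisymm hs (le_of_mul_le_mul_right (h ▸ hsum) hc)
  refine ⟨hcard, (Finset.sum_eq_sum_iff_of_le ht).1 ?_⟩
  rw [h, Finset.sum_const, nsmul_eq_mul, hcard]

theorem card_eq_and_forall_abs_eq_of_abs_sum_eq {ι : Type*} {s : Finset ι} {t : ι → ℝ} {N c : ℝ}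
    (hc : 0 < c) (hs : (s.card : ℝ) ≤ N) (ht : ∀ i ∈ s, |t i| ≤ c)
    (h : |∑ i ∈ s, t i| = N * c) :
    (s.card : ℝ) = N ∧ ∀ i ∈ s, |t i| = c ∧ t i = (∑ j ∈ s, t j) / N := by
  obtain ⟨hcard, a, ha, hta⟩ : (s.card : ℝ) = N ∧ ∃ a : ℝ, |a| = c ∧ ∀ i ∈ s, t i = a := by
    rcases abs_choice (∑ i ∈ s, t i) with hsign | hsign
    · obtain ⟨hcard, htc⟩ := card_eq_and_forall_eq_of_sum_eq hc hs
        (fun i hi => (le_abs_self _).trans (ht i hi)) (hsign ▸ h)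
      exact ⟨hcard, c, abs_of_pos hc, htc⟩
    · rw [hsign, ← Finset.sum_neg_distrib] at h
      obtain ⟨hcard, htc⟩ := card_eq_and_forall_eq_of_sum_eq hc hs
        (fun i hi => (neg_le_abs _).trans (ht i hi)) h
      exact ⟨hcard, -c, by rw [abs_neg, abs_of_pos hc], fun i hi => neg_eq_iff_eq_neg.1 (htc i hi)⟩
  refine ⟨hcard, fun i hi => ⟨by rw [hta i hi, ha], ?_⟩⟩
  have hN : N ≠ 0 := hcard ▸ Nat.cast_ne_zero.2 (Finset.card_ne_zero_of_mem hi)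
  rw [Finset.sum_congr rfl hta, Finset.sum_const, nsmul_eq_mul, hcard, hta i hi,
    mul_div_cancel_left₀ a hN]

/-- Maximality of a 4-tuple of affine flags: equality in the bound
`|affineB F| ≤ n (n² - 1) / 6 * v₃`. -/
def IsMaximal (F : Fin 4 → AffineFlag n) : Prop :=
  |affineB F| = (n : ℝ) * ((n : ℝ) ^ 2 - 1) / 6 * v₃

theorem IsMaximal.of_affineB_eq (hmax : IsMaximal F) (heq : affineB F' = affineB F) :
    IsMaximal F' := by
  rwa [IsMaximal, heq]

theorem card_support_eq_and_abs_term_eq (hmax : IsMaximal F) :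
    (support F).card = (dimensionTriples (n - 1)).card ∧ ∀ J ∈ support F, |term F J| = v₃ ∧
      term F J = affineB F / (dimensionTriples (n - 1)).card := by
  have hcard : (support F).card ≤ (dimensionTriples (n - 1)).card :=
    Finset.card_le_card_of_injOn (dimensions F) (fun J hJ => dimensions_mem hJ)
      (dimensions_injOn F)
  rw [IsMaximal, affineB_eq_sum_support, ← cast_card_dimensionTriples] at hmax
  rw [affineB_eq_sum_support, ← Nat.cast_inj (R := ℝ)]
  exact card_eq_and_forall_abs_eq_of_abs_sum_eq v₃_pos (Nat.cast_le.2 hcard)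
    (fun J _ => abs_Vol_le_v₃ _) hmax

theorem exists_dimensions_eq (hmax : IsMaximal F)
    {x : Σ _ : ℕ, Σ _ : ℕ, ℕ} (hx : x ∈ dimensionTriples (n - 1)) :
    ∃ J ∈ support F, dimensions F J = x :=
  Finset.surjOn_of_injOn_of_card_le (dimensions F) (fun _ hJ => dimensions_mem hJ)
    (dimensions_injOn F) (card_support_eq_and_abs_term_eq hmax).1.ge hx

end Terms

/-! ## Rigidity -/

section Rigidity

open Module

namespace CompleteFlag

variable {n : ℕ}

theorem toAffine_toCompleteFlag (F : CompleteFlag n) : F.toAffine.toCompleteFlag = F :=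
  F.exists_affineFlag.choose_spec

theorem subspace_last (F : CompleteFlag n) : F.subspace (Fin.last n) = ⊤ := by
  apply Submodule.eq_top_of_finrank_eq
  rw [F.finrank_subspace, finrank_fin_fun, Fin.val_last]

theorem subspace_zero (F : CompleteFlag n) : F.subspace 0 = ⊥ := by
  rw [← Submodule.finrank_eq_zero (R := ℂ), F.finrank_subspace, Fin.val_zero]

end CompleteFlag

variable {n : ℕ} {F F' : Fin 4 → AffineFlag n} {k : Fin n}

theorem exists_common_index (hF : ∀ i, i ≠ 3 → F' i = F i) (hmax : IsMaximal F)
    (heq : affineB F' = affineB F)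
    (hk : (F' 3).subspace k.castSucc = (F 3).subspace k.castSucc) {d : ℕ}
    (hkd : k ≤ d) (hd : d + 2 ≤ n) :
    ∃ J : Fin 4 → Fin n, J 3 = k ∧ finrank ℂ (span₂ F J) = d ∧ finrank ℂ (span₃ F J) + 2 = n ∧
      IsNondegenerate F J ∧ ∃ r : ℂ, (F' 3).vec k - r • (F 3).vec k ∈ lowerSpan F J := by
  have hmem : (⟨n - 2, d, (k : ℕ)⟩ : Σ _ : ℕ, Σ _ : ℕ, ℕ) ∈ dimensionTriples (n - 1) := by
    simp only [dimensionTriples, Finset.mem_sigma, Finset.mem_range]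
    omega
  have hmax' : IsMaximal F' := hmax.of_affineB_eq heq
  obtain ⟨J, hJ, hdim⟩ := exists_dimensions_eq hmax hmem
  obtain ⟨J', hJ', hdim'⟩ := exists_dimensions_eq hmax' hmem
  simp only [dimensions, Sigma.mk.injEq, heq_eq_eq] at hdim hdim'
  obtain ⟨hd₃, hd₂, hd₁⟩ := hdim
  obtain ⟨hd₃', hd₂', hd₁'⟩ := hdim'
  obtain rfl : J 3 = k := Fin.ext hd₁
  have hnd := isNondegenerate_of_mem_support hJ
  have hnd' := isNondegenerate_of_mem_support hJ'
  obtain rfl : J' = J := hnd.index_eq hnd' hF (Fin.ext hd₁') hk (hd₂'.trans hd₂.symm)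
    (hd₃'.trans hd₃.symm)
  have hlow : lowerSpan F' J' = lowerSpan F J' := lowerSpan_congr hF hk
  have hup : upperSpan F' J' = upperSpan F J' := by
    rw [hnd'.upperSpan_eq (i := 0) (j := 1) (by decide),
      hnd.upperSpan_eq (i := 0) (j := 1) (by decide), hlow, hF 0 (by decide), hF 1 (by decide)]
  obtain ⟨habs, hterm⟩ := (card_support_eq_and_abs_term_eq hmax).2 J' hJ
  have hterm' := ((card_support_eq_and_abs_term_eq hmax').2 J' hJ').2
  exact ⟨J', rfl, hd₂, by omega, hnd,
    exists_sub_smul_mem_lowerSpan hF hlow hup habs (by rw [hterm', hterm, heq])⟩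

theorem exists_sub_smul_mem_sup (hF : ∀ i, i ≠ 3 → F' i = F i) (hmax : IsMaximal F)
    (heq : affineB F' = affineB F)
    (hk : (F' 3).subspace k.castSucc = (F 3).subspace k.castSucc) (hkn : (k : ℕ) + 2 ≤ n) :
    ∃ (m : Fin n) (r : ℂ),
      finrank ℂ ↥((F 3).subspace k.castSucc ⊔ (F 0).subspace m.castSucc) + 2 ≤ n ∧
      (F' 3).vec k - r • (F 3).vec k ∈ (F 3).subspace k.castSucc ⊔ (F 0).subspace m.castSucc := by
  obtain ⟨J, rfl, hd₂, -, hnd, r, hr⟩ :=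
    exists_common_index hF hmax heq hk (d := n - 2) (by omega) (by omega)
  have hlow : span₂ F J = lowerSpan F J := by
    refine Submodule.eq_of_le_of_finrank_le (span₂_le_lowerSpan F J) ?_
    have := hnd.finrank_lowerSpan_add_two_le
    omega
  rw [← hlow] at hr
  exact ⟨J 0, r, by rw [← span₂]; omega, hr⟩

theorem sub_smul_mem_sup_castSucc (hF : ∀ i, i ≠ 3 → F' i = F i) (hmax : IsMaximal F)
    (heq : affineB F' = affineB F)
    (hk : (F' 3).subspace k.castSucc = (F 3).subspace k.castSucc) {j : Fin n} {r : ℂ}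
    (hj : finrank ℂ ↥((F 3).subspace k.castSucc ⊔ (F 0).subspace j.castSucc) + 2 ≤ n)
    (hmem : (F' 3).vec k - r • (F 3).vec k ∈
      (F 3).subspace k.castSucc ⊔ (F 0).subspace j.succ) :
    (F' 3).vec k - r • (F 3).vec k ∈ (F 3).subspace k.castSucc ⊔ (F 0).subspace j.castSucc := by
  rw [(F 0).subspace_succ, sup_left_comm, Submodule.mem_sup] at hmem
  obtain ⟨_, hz, g, hg, hzg⟩ := hmem
  obtain ⟨t, rfl⟩ := Submodule.mem_span_singleton.1 hz
  rw [← hzg]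
  refine add_mem ?_ hg
  by_cases hv : (F 0).vec j ∈ (F 3).subspace k.castSucc ⊔ (F 0).subspace j.castSucc
  · exact Submodule.smul_mem _ t hv
  have hkd : (k : ℕ) ≤ finrank ℂ ↥((F 3).subspace k.castSucc ⊔ (F 0).subspace j.castSucc) := by
    simpa only [(F 3).finrank_subspace, Fin.val_castSucc] using
      Submodule.finrank_mono (le_sup_left : (F 3).subspace k.castSucc ≤ _)
  obtain ⟨J, rfl, hd₂, -, hnd, s, hs⟩ := exists_common_index hF hmax heq hk hkd hj
  obtain rfl : J 0 = j := (F 0).eq_of_finrank_sup_eq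
    (fun h => hnd.vec_notMem 0 (span₂_le_lowerSpan F J h)) hv hd₂
  have hcomb : (s - r) • (F 3).vec (J 3) + (-t) • (F 0).vec (J 0) ∈ lowerSpan F J := by
    convert sub_mem (span₂_le_lowerSpan F J hg) hs using 1
    rw [eq_sub_of_add_eq' hzg]
    module
  have ht : t = 0 := neg_eq_zero.1 (hnd.eq_zero_of_combination_mem (by decide) hcomb).2
  rw [ht, zero_smul]
  exact zero_mem _

theorem exists_sub_smul_mem_subspace (hF : ∀ i, i ≠ 3 → F' i = F i) (hmax : IsMaximal F)
    (heq : affineB F' = affineB F)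
    (hk : (F' 3).subspace k.castSucc = (F 3).subspace k.castSucc) (hkn : (k : ℕ) + 2 ≤ n) :
    ∃ r : ℂ, (F' 3).vec k - r • (F 3).vec k ∈ (F 3).subspace k.castSucc := by
  obtain ⟨m, r, hfinrank, hm⟩ := exists_sub_smul_mem_sup hF hmax heq hk hkn
  have hdescend : ∀ j : Fin (n + 1), j ≤ m.castSucc →
      (F' 3).vec k - r • (F 3).vec k ∈ (F 3).subspace k.castSucc ⊔ (F 0).subspace j →
      (F' 3).vec k - r • (F 3).vec k ∈ (F 3).subspace k.castSucc := by
    intro j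
    induction j using Fin.induction with
    | zero =>
      intro _ hmem
      rwa [(F 0).subspace_zero, sup_bot_eq] at hmem
    | succ j ih =>
      intro hjm hmem
      have hlt : j < m := Fin.succ_le_castSucc_iff.1 hjm
      have hmono := Submodule.finrank_mono
        ((F 0).sup_subspace_le_sup_subspace ((F 3).subspace k.castSucc) hlt.le)
      exact ih (Fin.castSucc_le_castSucc_iff.2 hlt.le)
        (sub_smul_mem_sup_castSucc hF hmax heq hk (by omega) hmem)
  exact ⟨r, hdescend _ le_rfl hm⟩

theorem subspace_succ_eq (hF : ∀ i, i ≠ 3 → F' i = F i) (hmax : IsMaximal F)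
    (heq : affineB F' = affineB F)
    (hk : (F' 3).subspace k.castSucc = (F 3).subspace k.castSucc) :
    (F' 3).subspace k.succ = (F 3).subspace k.succ := by
  rcases eq_or_ne k.succ (Fin.last n) with hlast | hlast
  · rw [hlast, CompleteFlag.subspace_last, CompleteFlag.subspace_last]
  have hkn : (k : ℕ) + 2 ≤ n := by
    have := Fin.lt_last_iff_ne_last.2 hlast
    rw [Fin.lt_def, Fin.val_succ, Fin.val_last] at this
    omega
  obtain ⟨r, hr⟩ := exists_sub_smul_mem_subspace hF hmax heq hk hkn
  refine Submodule.eq_of_le_of_finrank_eq ?_ ?_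
  · rw [(F' 3).subspace_succ, (F 3).subspace_succ, hk]
    refine sup_le ((Submodule.span_singleton_le_iff_mem _ _).2 ?_) le_sup_right
    rw [← add_sub_cancel (r • (F 3).vec k) ((F' 3).vec k)]
    exact Submodule.add_mem_sup (Submodule.smul_mem _ r (Submodule.mem_span_singleton_self _)) hr
  · rw [(F' 3).finrank_subspace, (F 3).finrank_subspace]

theorem toCompleteFlag_eq_of_affineB_eq (hF : ∀ i, i ≠ 3 → F' i = F i) (hmax : IsMaximal F)
    (heq : affineB F' = affineB F) :
    (F' 3).toCompleteFlag = (F 3).toCompleteFlag := by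
  refine CompleteFlag.ext (funext fun j => ?_)
  induction j using Fin.induction with
  | zero => rw [CompleteFlag.subspace_zero, CompleteFlag.subspace_zero]
  | succ k hk => exact subspace_succ_eq hF hmax heq hk

end Rigidity

end FlagVolume

end

theorem mainTheorem6 (n : ℕ) (F₀ F₁ F₂ F₃ F : FlagVolume.CompleteFlag n)
    (hmax : |FlagVolume.B ![F₀, F₁, F₂, F₃]| =
      (n : ℝ) * ((n : ℝ) ^ 2 - 1) / 6 * FlagVolume.v₃)
    (hF : FlagVolume.B ![F₀, F₁, F₂, F] = FlagVolume.B ![F₀, F₁, F₂, F₃]) :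
    F = F₃ := by
  have hagree : ∀ i : Fin 4, i ≠ 3 →
      (![F₀, F₁, F₂, F] i).toAffine = (![F₀, F₁, F₂, F₃] i).toAffine := by
    intro i hi
    fin_cases i <;> first | rfl | exact absurd rfl hi
  have hflag : F.toAffine.toCompleteFlag = F₃.toAffine.toCompleteFlag :=
    FlagVolume.toCompleteFlag_eq_of_affineB_eq hagree hmax hF
  simpa only [FlagVolume.CompleteFlag.toAffine_toCompleteFlag] using hflag
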